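/- All graphs are finite and simple. For a positive integer $p$, the $p$-intersection number $\Theta_p(G)$ is the minimum cardinality of a set $U$ for which there is a function $S:V(G)\to 2^U$ such that distinct vertices $u,v$ are adjacent in $G$ if and only if $|S(u)\cap S(v)|\ge p$. For $d\ge 3$, let $G^*_{(d,d-2)}$ be the graph with vertex set $\{\mathbf x\in\{0,1\}^d : d-2\le \mathbf x\cdot\mathbf x\le d-1\}$ in which distinct $\mathbf x,\mathbf y$ are adjacent if and only if $\mathbf x\cdot\mathbf y\ge d-2$. The reduction $\mathcal R(G)$ arises from $G$ by identifying all pairs of twins, that is, of vertices with the same closed neighbourhood. $Forb(\mathcal F)$ is the class of graphs having no induced subgraph isomorphic to a member of $\mathcal F$. As usual, $K_n$, $P_n$, $C_n$, $\bar K_n$ are the complete graph, path, cycle and edgeless graph of order $n$, $\cup$ between graphs denotes disjoint union, and $2K_2=K_2\cup K_2$; $K_n-e$ arises by removing an edge from $K_n$. $K_{2,3}+e$ arises from $K_{2,3}$ by joining its two vertices of degree $3$. $K_r^{+(s)}$ arises from $K_r$ by adding $s$ pendant vertices to one vertex. $K_3^{+(s,1)}$ arises from $K_3$ by adding $s$ pendant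 vertices to one vertex and one more vertex adjacent to exactly the other two vertices of $K_3$. $K_3^{+(s,1,1)}$ arises from $K_3$ by adding $s$ pendant vertices to one vertex and one pendant vertex to each of the other two vertices. $(K_4-e)^{+(s)}$ arises by adding $s$ pendant vertices to a vertex of degree $3$ of $K_4-e$. **Theorem.** Let $G$ be a graph without isolated or universal vertices, and let $d\ge 3$ be an integer. The following statements are equivalent. (i) $\Theta_{d-2}(G)\le d$. (ii) $G$ arises by replacing the vertices of $G^*_{(d,d-2)}$ by possibly empty cliques (vertices in different cliques being adjacent exactly when the replaced vertices are). (iii) $\mathcal R(G)\in Forb(\mathcal F)$ for $$\begin{aligned}\mathcal F={}&\{2K_2,\ C_4,\ C_5,\ K_{2,3}+e,\ K_5-e\}\\ &\cup\{K_3^{+(d-2,1)},\ K_3^{+(d-2,1,1)},\ (K_4-e)^{+(d-2)}\}\\ &\cup\{K_i^{+(d+1-i)} : i=2\text{ or }4\le i\le d+1\}\\ &\cup\{K_2\cup\bar K_{\binom{d-1}{2}+1},\ K_3\cup\bar K_{\binom{d-2}{2}+1},\ P_4\cup\bar K_{\binom{d-2}{2}+1}\}\\ &\cup\{K_3^{+(1,1)}\cup\bar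 K_{\binom{d-3}{2}+1},\ K_3^{+(1,1,1)}\cup\bar K_{\binom{d-3}{2}+1},\ (K_4-e)\cup\bar K_{\binom{d-3}{2}+1}\}\\ &\cup\{K_i\cup\bar K_{\binom{d-i}{2}+1} : i=0\text{ or }4\le i\le d\}.\end{aligned}$$ -/

import Mathlib

namespace PIntersection

open SimpleGraph

/-! ### `p`-intersection representations -/

/-- `S` is a `p`-intersection representation of `G` with ground set `U`. -/
def IsIntersectionRep {V : Type*} {U : Type*} [DecidableEq U]
    (G : SimpleGraph V) (p : ℕ) (S : V → Finset U) : Prop :=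
  ∀ u v : V, u ≠ v → (G.Adj u v ↔ p ≤ (S u ∩ S v).card)

/-- The `p`-intersection number `Θ_p(G)`: the minimum cardinality of the ground set of a
`p`-intersection representation of `G`. It takes values in `ℕ∞`, so that it would be `⊤` if `G` had
no such representation over a finite ground set. -/
noncomputable def intersectionNumber {V : Type*} (G : SimpleGraph V) (p : ℕ) : ℕ∞ :=
  sInf {N : ℕ∞ | ∃ n : ℕ, N = (n : ℕ∞) ∧
    ∃ S : V → Finset (Fin n), IsIntersectionRep G p S}

/-! ### Replacing vertices by cliques -/

/-- The graph obtained from `G₀` by replacing each vertex `w` by a (possibly empty) clique of order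
`n w`. -/
def replaceByCliques {W : Type*} (G₀ : SimpleGraph W) (n : W → ℕ) :
    SimpleGraph (Σ w : W, Fin (n w)) where
  Adj a b := a ≠ b ∧ (a.1 = b.1 ∨ G₀.Adj a.1 b.1)
  symm := ⟨fun _ _ h => ⟨h.1.symm, h.2.imp Eq.symm SimpleGraph.Adj.symm⟩⟩
  loopless := ⟨fun _ h => h.1 rfl⟩

/-- `G` arises by replacing the vertices of `G₀` by possibly empty cliques. -/
def ArisesByCliques {V W : Type*} (G : SimpleGraph V) (G₀ : SimpleGraph W) : Prop :=
  ∃ n : W → ℕ, Nonempty (G ≃g replaceByCliques G₀ n)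

/-- The dot product of two binary vectors, as a natural number. -/
def dot {d : ℕ} (x y : Fin d → Fin 2) : ℕ := ∑ i, (x i : ℕ) * (y i : ℕ)

/-- The graph `G*_{(d,d-2)}` on the binary vectors `x` with `d - 2 ≤ x ⬝ x ≤ d - 1`, distinct
`x` and `y` being adjacent if and only if `x ⬝ y ≥ d - 2`. Used for `d ≥ 3` only. -/
def gStar (d : ℕ) :
    SimpleGraph {x : Fin d → Fin 2 // d - 2 ≤ dot x x ∧ dot x x ≤ d - 1} where
  Adj x y := x ≠ y ∧ d - 2 ≤ dot x.1 y.1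
  symm := ⟨fun x y h => ⟨h.1.symm, by
    have e : dot y.1 x.1 = dot x.1 y.1 := Finset.sum_congr rfl fun i _ => Nat.mul_comm _ _
    rw [e]; exact h.2⟩⟩
  loopless := ⟨fun _ h => h.1 rfl⟩

/-! ### Twins and the reduction -/

/-- The closed neighbourhood `N_G[u]`. -/
def closedNbhd {V : Type*} (G : SimpleGraph V) (u : V) : Set V := insert u (G.neighborSet u)

/-- Two vertices are identified if they have the same closed neighbourhood. -/
def twinSetoid {V : Type*} (G : SimpleGraph V) : Setoid V where
  r u v := closedNbhd G u = closedNbhd G v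
  iseqv := ⟨fun _ => rfl, fun h => h.symm, fun h h' => h.trans h'⟩

/-- The reduction `R(G)`, obtained from `G` by identifying all pairs of twins. -/
def reduction {V : Type*} (G : SimpleGraph V) : SimpleGraph (Quotient (twinSetoid G)) :=
  G.map (Quotient.mk (twinSetoid G))

/-! ### Forbidden induced subgraphs -/

/-- `H` belongs to `Forb(F)`: no graph of the family is (isomorphic to) an induced subgraph of
`H`. -/
def Forb {V : Type*} (F : Set (Σ W : Type, SimpleGraph W)) (H : SimpleGraph V) : Prop :=
  ∀ A ∈ F, ¬ A.2.IsIndContained H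

/-- The complete graph `K_n`. -/
abbrev K (n : ℕ) : SimpleGraph (Fin n) := ⊤

/-- The edgeless graph on `n` vertices. -/
abbrev Kbar (n : ℕ) : SimpleGraph (Fin n) := ⊥

/-- The graph obtained from `A` by adding a set `ι` of new, pairwise nonadjacent vertices, the new
vertex `i` being adjacent exactly to the vertices in `N i`. -/
def attach {V ι : Type*} (A : SimpleGraph V) (N : ι → Set V) : SimpleGraph (V ⊕ ι) where
  Adj
    | .inl u, .inl v => A.Adj u v
    | .inl u, .inr i => u ∈ N i
    | .inr i, .inl u => u ∈ N i
    | .inr _, .inr _ => False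
  symm := ⟨by
    rintro (u | i) (v | j) h
    · exact SimpleGraph.Adj.symm h
    · exact h
    · exact h
    · exact h⟩
  loopless := ⟨by
    rintro (u | i) h
    · exact A.irrefl h
    · exact h⟩

/-- `K_{2,3} + e`: the two vertices of degree `3` of `K_{2,3}` are joined by an edge. -/
def K23PlusEdge : SimpleGraph (Fin 2 ⊕ Fin 3) :=
  completeBipartiteGraph (Fin 2) (Fin 3) ⊔ edge (Sum.inl 0) (Sum.inl 1)

/-- `K_4 - e`; the vertices of degree `3` are `2` and `3`. -/
def K4MinusEdge : SimpleGraph (Fin 4) := (K 4).deleteEdges {s(0, 1)}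

/-- `K_5 - e`. -/
def K5MinusEdge : SimpleGraph (Fin 5) := (K 5).deleteEdges {s(0, 1)}

/-- `K_r^{+(s)}` for `r ≥ 1`: `s` pendant vertices are added to the vertex `0` of `K_r`. -/
def KPend (r s : ℕ) : SimpleGraph (Fin r ⊕ Fin s) :=
  attach (K r) (fun _ => {v | v.val = 0})

/-- `K_3^{+(s,1)}`: `s` pendant vertices are added to the vertex `0` of `K_3`, and one more vertex
is made adjacent to the vertices `1` and `2`. -/
def K3Pend1 (s : ℕ) : SimpleGraph (Fin 3 ⊕ (Fin s ⊕ Fin 1)) :=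
  attach (K 3) (Sum.elim (fun _ => {0}) (fun _ => {1, 2}))

/-- `K_3^{+(s,1,1)}`: `s` pendant vertices are added to the vertex `0` of `K_3`, and one pendant
vertex to each of the vertices `1` and `2`. -/
def K3Pend11 (s : ℕ) : SimpleGraph (Fin 3 ⊕ (Fin s ⊕ Fin 2)) :=
  attach (K 3) (Sum.elim (fun _ => {0}) (fun j => {j.succ}))

/-- `(K_4 - e)^{+(s)}`: `s` pendant vertices are added to a vertex of degree `3` of `K_4 - e`. -/
def K4MinusEdgePend (s : ℕ) : SimpleGraph (Fin 4 ⊕ Fin s) :=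
  attach K4MinusEdge (fun _ => {2})

/-- The explicit family of forbidden induced subgraphs (used for `d ≥ 3` only). -/
def forbiddenFamily (d : ℕ) : Set (Σ W : Type, SimpleGraph W) :=
  {⟨_, K 2 ⊕g K 2⟩, ⟨_, cycleGraph 4⟩, ⟨_, cycleGraph 5⟩, ⟨_, K23PlusEdge⟩, ⟨_, K5MinusEdge⟩} ∪
  {⟨_, K3Pend1 (d - 2)⟩, ⟨_, K3Pend11 (d - 2)⟩, ⟨_, K4MinusEdgePend (d - 2)⟩} ∪
  {A | ∃ i : ℕ, (i = 2 ∨ (4 ≤ i ∧ i ≤ d + 1)) ∧ A = ⟨_, KPend i (d + 1 - i)⟩} ∪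
  {⟨_, K 2 ⊕g Kbar ((d - 1).choose 2 + 1)⟩, ⟨_, K 3 ⊕g Kbar ((d - 2).choose 2 + 1)⟩,
    ⟨_, pathGraph 4 ⊕g Kbar ((d - 2).choose 2 + 1)⟩} ∪
  {⟨_, K3Pend1 1 ⊕g Kbar ((d - 3).choose 2 + 1)⟩, ⟨_, K3Pend11 1 ⊕g Kbar ((d - 3).choose 2 + 1)⟩,
    ⟨_, K4MinusEdge ⊕g Kbar ((d - 3).choose 2 + 1)⟩} ∪
  {A | ∃ i : ℕ, (i = 0 ∨ (4 ≤ i ∧ i ≤ d)) ∧ A = ⟨_, K i ⊕g Kbar ((d - i).choose 2 + 1)⟩}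

end PIntersection

namespace PIntersection

open SimpleGraph

/-! ### Pair models -/

/-! All three statements amount to the existence of a pair model. Passing to complements in a
`d`-set turns `|S(u) ∩ S(v)| ≥ d - 2` into a bound of two on the order of the union of the
complements. A vertex with a neighbour has a complement of order at most two, and a vertex that is
not universal has a nonempty one. The zero sets of the vectors of `gStar d` are exactly the sets of
order one or two.

In the reduction the model can be taken injective. Singletons are then pairwise adjacent, distinct
pairs are nonadjacent, and a pair is adjacent exactly to the singletons it contains. So the reduced
graph splits into a clique `C` of singletons and an independent set of pairs. A pair with
neighbourhood `S` in `C` is fixed by `2 - |S|` points among the `d - |C|` points not used by `C`, so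
at most `(d - |C|).choose (2 - |S|)` vertices share the neighbourhood `S`. This is
`IsPairModel.card_le_choose`; conversely, `exists_isPairModel_of_split` builds a model from any
split partition obeying these bounds.

Every forbidden graph violates them: an edge has a singleton end, a vertex with three neighbours is
a singleton, and once enough singletons are forced there are too many pairs. For the converse,
`Forb.exists_isPairModel` chooses `C` according to the structure of the graph: a maximum clique if
it has order at least four; otherwise a triangle of a diamond, a triangle all of whose vertices have
outside neighbours, two vertices of a triangle whose third vertex has none, the middle edge of an
induced path of order four, the centre of a star, or the empty set. In each case some forbidden
graphs give the split partition and the others give exactly the required bounds. -/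

/-- The complements of the binary vectors in `gStar d` are the subsets of `Fin d` of order one or
two. A pair model assigns such a set to each vertex, so that adjacency means that the union of the
two sets has order at most two. -/
structure IsPairModel {V : Type*} (G : SimpleGraph V) {d : ℕ} (A : V → Finset (Fin d)) : Prop where
  one_le : ∀ u, 1 ≤ (A u).card
  le_two : ∀ u, (A u).card ≤ 2
  adj_iff : ∀ u v, u ≠ v → (G.Adj u v ↔ (A u ∪ A v).card ≤ 2)

/-- A representation on fewer points is also one on `d` points, so attaining the infimum somewhere
below `d` is enough. -/
theorem intersectionNumber_le_iff {V : Type*} (G : SimpleGraph V) (p d : ℕ) :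
    intersectionNumber G p ≤ d ↔ ∃ S : V → Finset (Fin d), IsIntersectionRep G p S := by
  constructor
  · intro h
    have hne : {N : ℕ∞ | ∃ n : ℕ, N = (n : ℕ∞) ∧
        ∃ S : V → Finset (Fin n), IsIntersectionRep G p S}.Nonempty := by
      by_contra hne
      rw [Set.not_nonempty_iff_eq_empty] at hne
      rw [intersectionNumber, hne, sInf_empty, top_le_iff] at h
      exact ENat.natCast_ne_top d h
    obtain ⟨n, hn, S, hS⟩ := csInf_mem hne
    have hnd : n ≤ d := by
      rw [intersectionNumber, hn] at h
      exact_mod_cast h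
    refine ⟨fun v => (S v).map (Fin.castLEEmb hnd), fun u v huv => ?_⟩
    rw [← Finset.map_inter, Finset.card_map]
    exact hS u v huv
  · rintro ⟨S, hS⟩
    exact sInf_le ⟨d, rfl, S, hS⟩

theorem card_compl_inter_compl {d : ℕ} (A B : Finset (Fin d)) :
    (Aᶜ ∩ Bᶜ).card = d - (A ∪ B).card := by
  rw [← Finset.compl_union, Finset.card_compl, Fintype.card_fin]

theorem sub_two_le_sub_iff {d k : ℕ} (hd : 3 ≤ d) (hk : k ≤ d) : d - 2 ≤ d - k ↔ k ≤ 2 := by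
  omega

theorem card_le_dim {d : ℕ} (A : Finset (Fin d)) : A.card ≤ d := by
  simpa using Finset.card_le_univ A

theorem intersectionNumber_le_iff_exists_isPairModel {V : Type*} (G : SimpleGraph V)
    (hisolated : ∀ u : V, ¬ G.IsIsolated u) (huniversal : ∀ u : V, ¬ G.IsUniversal u)
    (d : ℕ) (hd : 3 ≤ d) :
    intersectionNumber G (d - 2) ≤ (d : ℕ∞) ↔ ∃ A : V → Finset (Fin d), IsPairModel G A := by
  rw [intersectionNumber_le_iff]
  constructor
  · rintro ⟨S, hS⟩
    have hadj : ∀ u v, u ≠ v → (G.Adj u v ↔ ((S u)ᶜ ∪ (S v)ᶜ).card ≤ 2) := fun u v huv => by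
      rw [hS u v huv, ← sub_two_le_sub_iff hd (card_le_dim _), ← card_compl_inter_compl,
        compl_compl, compl_compl]
    have htwo : ∀ u, ((S u)ᶜ).card ≤ 2 := fun u => by
      obtain ⟨v, hv⟩ := not_forall.1 (hisolated u)
      rw [not_not] at hv
      exact (Finset.card_le_card Finset.subset_union_left).trans ((hadj u v hv.ne).1 hv)
    refine ⟨fun u => (S u)ᶜ, fun u => ?_, htwo, hadj⟩
    by_contra h
    -- With an empty complement at `u`, every union is just the complement at `v`, which has order
    -- at most two.
    refine huniversal u fun v huv => (hadj u v huv).2 ?_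
    rw [Finset.card_eq_zero.1 (by omega : ((S u)ᶜ).card = 0), Finset.empty_union]
    exact htwo v
  · rintro ⟨A, hA⟩
    refine ⟨fun u => (A u)ᶜ, fun u v huv => ?_⟩
    rw [card_compl_inter_compl, sub_two_le_sub_iff hd (card_le_dim _), hA.adj_iff u v huv]

/-! ### Clique replacements and the graph `gStar d` -/

/-- The cliques are the fibres of `f`, and finiteness of `V` lets each fibre be enumerated. -/
theorem arisesByCliques_iff {V W : Type*} [Finite V] (G : SimpleGraph V) (G₀ : SimpleGraph W) :
    ArisesByCliques G G₀ ↔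
      ∃ f : V → W, ∀ u v, u ≠ v → (G.Adj u v ↔ f u = f v ∨ G₀.Adj (f u) (f v)) := by
  constructor
  · rintro ⟨n, ⟨e⟩⟩
    refine ⟨fun v => (e v).1, fun u v huv => ?_⟩
    rw [← e.map_adj_iff]
    exact and_iff_right (e.injective.ne huv)
  · rintro ⟨f, hf⟩
    let e : V ≃ Σ w : W, Fin (Nat.card {v // f v = w}) :=
      (Equiv.sigmaFiberEquiv f).symm.trans (Equiv.sigmaCongrRight fun w => Finite.equivFin _)
    have he : ∀ v, (e v).1 = f v := fun v => rfl
    refine ⟨_, ⟨⟨e, fun {u v} => ?_⟩⟩⟩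
    change (e u ≠ e v ∧ ((e u).1 = (e v).1 ∨ G₀.Adj (e u).1 (e v).1)) ↔ _
    rw [he, he, e.injective.ne_iff]
    constructor
    · rintro ⟨h, h'⟩
      exact (hf u v h).2 h'
    · intro h
      exact ⟨h.ne, (hf u v h.ne).1 h⟩

/-- The set of coordinates in which a binary vector vanishes. -/
def zeros {d : ℕ} (x : Fin d → Fin 2) : Finset (Fin d) := Finset.univ.filter fun i => x i = 0

theorem dot_eq {d : ℕ} (x y : Fin d → Fin 2) : dot x y = d - (zeros x ∪ zeros y).card := by
  have h : (zeros x)ᶜ ∩ (zeros y)ᶜ = Finset.univ.filter fun i => x i ≠ 0 ∧ y i ≠ 0 := by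
    ext i
    simp [zeros]
  rw [← card_compl_inter_compl, h, Finset.card_filter]
  refine Finset.sum_congr rfl fun i _ => ?_
  generalize x i = a
  generalize y i = b
  fin_cases a <;> fin_cases b <;> rfl

theorem arisesByCliques_gStar_iff {V : Type*} [Finite V] (G : SimpleGraph V)
    (d : ℕ) (hd : 3 ≤ d) :
    ArisesByCliques G (gStar d) ↔ ∃ A : V → Finset (Fin d), IsPairModel G A := by
  have hdot : ∀ x y : Fin d → Fin 2, d - 2 ≤ dot x y ↔ (zeros x ∪ zeros y).card ≤ 2 :=
    fun x y => by rw [dot_eq, sub_two_le_sub_iff hd (card_le_dim _)]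
  have hle : ∀ x : Fin d → Fin 2, dot x x ≤ d - 1 ↔ 1 ≤ (zeros x).card := fun x => by
    rw [dot_eq, Finset.union_self]
    omega
  rw [arisesByCliques_iff]
  constructor
  · rintro ⟨f, hf⟩
    refine ⟨fun v => zeros (f v).1, fun v => (hle _).1 (f v).2.2,
      fun v => by simpa using (hdot _ _).1 (f v).2.1, fun u v huv => ?_⟩
    rw [hf u v huv, ← hdot]
    constructor
    · rintro (h | h)
      · rw [h]
        exact (f v).2.1
      · exact h.2
    · intro h
      exact or_iff_not_imp_left.2 fun h' => ⟨h', h⟩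
  · rintro ⟨A, hA⟩
    let x : V → Fin d → Fin 2 := fun v i => if i ∈ A v then 0 else 1
    have hx : ∀ v, zeros (x v) = A v := fun v => by
      ext i
      simp [zeros, x]
    refine ⟨fun v => ⟨x v, ?_, ?_⟩, fun u v huv => ?_⟩
    · rw [hdot, hx, Finset.union_self]
      exact hA.le_two v
    · rw [hle, hx]
      exact hA.one_le v
    · rw [hA.adj_iff u v huv]
      change _ ↔ _ ∨ (_ ∧ d - 2 ≤ dot (x u) (x v))
      rw [hdot, hx, hx]
      constructor
      · intro h
        exact or_iff_not_imp_left.2 fun h' => ⟨h', h⟩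
      · rintro (h | h)
        · have huv' : A u = A v := by
            rw [← hx u, ← hx v]
            exact congrArg zeros (Subtype.ext_iff.1 h)
          rw [huv', Finset.union_self]
          exact hA.le_two v
        · exact h.2

/-! ### Twins and injective models of the reduction -/

theorem mem_closedNbhd {V : Type*} (G : SimpleGraph V) (u v : V) :
    v ∈ closedNbhd G u ↔ v = u ∨ G.Adj u v := Iff.rfl

/-- Representatives are exchanged one end at a time through equal closed neighbourhoods; since the
two classes differ, membership in a closed neighbourhood means adjacency. -/
theorem reduction_adj {V : Type*} (G : SimpleGraph V) (u v : V) :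
    (reduction G).Adj (Quotient.mk (twinSetoid G) u) (Quotient.mk (twinSetoid G) v) ↔
      Quotient.mk (twinSetoid G) u ≠ Quotient.mk (twinSetoid G) v ∧ G.Adj u v := by
  refine and_congr_right fun hne => ⟨?_, fun h => ⟨u, v, h, rfl, rfl⟩⟩
  rintro ⟨u', v', h, hu, hv⟩
  have hu' : closedNbhd G u' = closedNbhd G u := Quotient.exact hu
  have hv' : closedNbhd G v' = closedNbhd G v := Quotient.exact hv
  have h1 : v' ∈ closedNbhd G u := hu' ▸ (mem_closedNbhd G _ _).2 (.inr h)
  have h2 : u ∈ closedNbhd G v' := by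
    rcases h1 with h1 | h1
    · exact absurd (h1 ▸ hv) hne
    · exact .inr h1.symm
  rw [hv'] at h2
  rcases h2 with h2 | h2
  · exact absurd (congrArg _ h2) hne
  · exact h2.symm

theorem IsPairModel.comp {V W : Type*} {G : SimpleGraph V} {H : SimpleGraph W} {d : ℕ}
    {A : V → Finset (Fin d)} (hA : IsPairModel G A) (f : H ↪g G) : IsPairModel H (A ∘ f) :=
  ⟨fun u => hA.one_le _, fun u => hA.le_two _, fun u v huv => by
    rw [← f.map_adj_iff]
    exact hA.adj_iff _ _ (f.injective.ne huv)⟩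

/-- Vertices carrying the same set are adjacent and have the same other neighbours, hence are twins;
so a model restricted to one representative per class is injective. Conversely, twins may share a
set. -/
theorem exists_isPairModel_iff_reduction {V : Type*} (G : SimpleGraph V) (d : ℕ) :
    (∃ A : V → Finset (Fin d), IsPairModel G A) ↔
      ∃ A : Quotient (twinSetoid G) → Finset (Fin d),
        Function.Injective A ∧ IsPairModel (reduction G) A := by
  constructor
  · rintro ⟨A, hA⟩
    have hout : ∀ q : Quotient (twinSetoid G), Quotient.mk (twinSetoid G) q.out = q :=
      fun q => q.out_eq
    refine ⟨fun q => A q.out, fun p q h => ?_, fun q => hA.one_le _, fun q => hA.le_two _,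
      fun p q hpq => ?_⟩
    · by_contra hpq
      have hne : p.out ≠ q.out := fun h' => hpq (by rw [← hout p, ← hout q, h'])
      refine hpq ?_
      rw [← hout p, ← hout q]
      have hadj : G.Adj p.out q.out := (hA.adj_iff _ _ hne).2 (by
        have h' : A p.out = A q.out := h
        rw [h', Finset.union_self]
        exact hA.le_two _)
      refine Quotient.sound (Set.ext fun a => ?_)
      rw [mem_closedNbhd, mem_closedNbhd]
      by_cases hap : a = p.out
      · simp [hap, hadj.symm]
      by_cases haq : a = q.out
      · simp [haq, hadj]
      have h' : A p.out = A q.out := h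
      rw [hA.adj_iff _ _ (Ne.symm hap), hA.adj_iff _ _ (Ne.symm haq), h']
      simp [hap, haq]
    · have hne : p.out ≠ q.out := fun h' => hpq (by rw [← hout p, ← hout q, h'])
      rw [← hA.adj_iff _ _ hne]
      have := reduction_adj G p.out q.out
      rw [hout, hout] at this
      rw [this]
      exact and_iff_right hpq
  · rintro ⟨A, -, hA⟩
    refine ⟨fun v => A (Quotient.mk _ v), fun v => hA.one_le _, fun v => hA.le_two _,
      fun u v huv => ?_⟩
    by_cases h : Quotient.mk (twinSetoid G) u = Quotient.mk (twinSetoid G) v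
    · have h' : closedNbhd G u = closedNbhd G v := Quotient.exact h
      have hadj : G.Adj u v := by
        have : u ∈ closedNbhd G v := h' ▸ Or.inl rfl
        rcases this with h1 | h1
        · exact absurd h1 huv
        · exact h1.symm
      rw [h, Finset.union_self]
      exact iff_of_true hadj (hA.le_two _)
    · rw [← hA.adj_iff _ _ h, reduction_adj]
      exact (and_iff_right h).symm

/-! ### The forbidden graphs have no injective pair model -/

section Necessity

variable {W : Type*} {H : SimpleGraph W} {d : ℕ} {A : W → Finset (Fin d)}

theorem IsPairModel.card_eq_one_or_two (hA : IsPairModel H A) (u : W) :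
    (A u).card = 1 ∨ (A u).card = 2 := by
  have := hA.one_le u
  have := hA.le_two u
  omega

/-- A set of order at most two that contains a pair is that pair. -/
theorem IsPairModel.adj_pair_iff (hA : IsPairModel H A) {u v : W} (huv : u ≠ v)
    (hu : (A u).card = 2) : H.Adj u v ↔ A v ⊆ A u := by
  rw [hA.adj_iff u v huv]
  constructor
  · intro h
    have := Finset.eq_of_subset_of_card_le (Finset.subset_union_left (s₁ := A u) (s₂ := A v))
      (by omega)
    rw [this]
    exact Finset.subset_union_right
  · intro h
    rw [Finset.union_eq_left.2 h, hu]

theorem IsPairModel.adj_of_card_eq_one (hA : IsPairModel H A) {u v : W} (huv : u ≠ v)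
    (hu : (A u).card = 1) (hv : (A v).card = 1) : H.Adj u v := by
  rw [hA.adj_iff u v huv]
  have := Finset.card_union_le (A u) (A v)
  omega

theorem IsPairModel.card_eq_two_of_not_adj (hA : IsPairModel H A) {u v : W} (huv : u ≠ v)
    (hu : (A u).card = 1) (h : ¬ H.Adj u v) : (A v).card = 2 :=
  (hA.card_eq_one_or_two v).resolve_left fun hv => h (hA.adj_of_card_eq_one huv hu hv)

theorem IsPairModel.card_eq_one_of_adj (hA : IsPairModel H A) (hinj : Function.Injective A)
    {u v : W} (hu : (A u).card = 2) (h : H.Adj u v) : (A v).card = 1 := by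
  refine (hA.card_eq_one_or_two v).resolve_right fun hv => h.ne ?_
  exact (hinj (Finset.eq_of_subset_of_card_le ((hA.adj_pair_iff h.ne hu).1 h) (by omega))).symm

theorem IsPairModel.card_eq_one_or_of_adj (hA : IsPairModel H A) (hinj : Function.Injective A)
    {u v : W} (h : H.Adj u v) : (A u).card = 1 ∨ (A v).card = 1 :=
  (hA.card_eq_one_or_two u).imp_right fun hu => hA.card_eq_one_of_adj hinj hu h

/-- The neighbours of a pair are singletons inside it, and there are only two of these. -/
theorem IsPairModel.card_eq_one_of_three_adj (hA : IsPairModel H A) (hinj : Function.Injective A)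
    {u : W} (S : Finset W) (hS : 3 ≤ S.card) (h : ∀ v ∈ S, H.Adj u v) : (A u).card = 1 := by
  refine (hA.card_eq_one_or_two u).resolve_right fun hu => ?_
  have hsub : S.image A ⊆ (A u).powersetCard 1 := by
    intro B hB
    obtain ⟨v, hv, rfl⟩ := Finset.mem_image.1 hB
    exact Finset.mem_powersetCard.2 ⟨(hA.adj_pair_iff (h v hv).ne hu).1 (h v hv),
      hA.card_eq_one_of_adj hinj hu (h v hv)⟩
  have := Finset.card_le_card hsub
  rw [Finset.card_image_of_injective _ hinj, Finset.card_powersetCard, hu] at this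
  simp at this
  omega

theorem IsPairModel.card_eq_one_of_adj₃ (hA : IsPairModel H A) (hinj : Function.Injective A)
    {u v₁ v₂ v₃ : W} (h₁ : H.Adj u v₁) (h₂ : H.Adj u v₂) (h₃ : H.Adj u v₃)
    (h₁₂ : v₁ ≠ v₂) (h₁₃ : v₁ ≠ v₃) (h₂₃ : v₂ ≠ v₃) : (A u).card = 1 := by
  classical
  refine hA.card_eq_one_of_three_adj hinj {v₁, v₂, v₃} ?_ (by simp [h₁, h₂, h₃])
  rw [Finset.card_eq_three.2 ⟨_, _, _, h₁₂, h₁₃, h₂₃, rfl⟩]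

theorem card_biUnion_of_card_eq_one (hinj : Function.Injective A)
    (T : Finset W) (hT : ∀ t ∈ T, (A t).card = 1) : (T.biUnion A).card = T.card := by
  rw [Finset.card_biUnion, Finset.sum_congr rfl hT, Finset.sum_const, smul_eq_mul, mul_one]
  intro s hs t ht hst
  obtain ⟨a, ha⟩ := Finset.card_eq_one.1 (hT s hs)
  obtain ⟨b, hb⟩ := Finset.card_eq_one.1 (hT t ht)
  rw [Function.onFun, ha, hb, Finset.disjoint_singleton]
  rintro rfl
  exact hst (hinj (ha.trans hb.symm))

/-- At most `(d - |T|).choose (2 - |N|)` pairs have prescribed neighbours `N` in a set `T` of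
singletons. -/
theorem IsPairModel.card_le_choose (hA : IsPairModel H A) (hinj : Function.Injective A)
    (T N : Finset W) (hNT : N ⊆ T) (hT : ∀ t ∈ T, (A t).card = 1) (M : Finset W)
    (hM : ∀ m ∈ M, (A m).card = 2) (hadj : ∀ m ∈ M, ∀ t ∈ T, H.Adj m t ↔ t ∈ N) :
    M.card ≤ (d - T.card).choose (2 - N.card) := by
  classical
  have hcard : ∀ S ⊆ T, (S.biUnion A).card = S.card := fun S hS =>
    card_biUnion_of_card_eq_one hinj S fun t ht => hT t (hS ht)
  -- All members of `M` have the same trace on the points of `T`, so they are told apart by their `2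
  -- - |N|` points outside.
  have hinter : ∀ m ∈ M, A m ∩ T.biUnion A = N.biUnion A := by
    intro m hm
    ext x
    simp only [Finset.mem_inter, Finset.mem_biUnion]
    have key : ∀ t ∈ T, x ∈ A t → (x ∈ A m ↔ t ∈ N) := by
      intro t ht hx
      obtain ⟨a, ha⟩ := Finset.card_eq_one.1 (hT t ht)
      have hmt : m ≠ t := by
        rintro rfl
        have := hM m hm
        have := hT m ht
        omega
      rw [← hadj m hm t ht, hA.adj_pair_iff hmt (hM m hm), ha, Finset.singleton_subset_iff]
      rw [ha, Finset.mem_singleton] at hx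
      rw [hx]
    constructor
    · rintro ⟨hx, t, ht, hxt⟩
      exact ⟨t, (key t ht hxt).1 hx, hxt⟩
    · rintro ⟨t, ht, hxt⟩
      exact ⟨(key t (hNT ht) hxt).2 ht, t, hNT ht, hxt⟩
  have hmaps : ∀ m ∈ M, A m \ T.biUnion A ∈ ((T.biUnion A)ᶜ).powersetCard (2 - N.card) := by
    intro m hm
    rw [Finset.mem_powersetCard]
    refine ⟨fun x hx => Finset.mem_compl.2 (Finset.mem_sdiff.1 hx).2, ?_⟩
    have := Finset.card_sdiff_add_card_inter (A m) (T.biUnion A)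
    rw [hinter m hm, hcard N hNT, hM m hm] at this
    omega
  have h := Finset.card_le_card_of_injOn _ hmaps (by
    intro m hm m' hm' h
    refine hinj ?_
    have h' : A m \ T.biUnion A = A m' \ T.biUnion A := h
    rw [← Finset.sdiff_union_inter (A m) (T.biUnion A), h', hinter m hm, ← hinter m' hm',
      Finset.sdiff_union_inter])
  rwa [Finset.card_powersetCard, Finset.card_compl, Fintype.card_fin,
    hcard T (Finset.Subset.refl T)] at h

theorem IsPairModel.le_choose_of_pairs (hA : IsPairModel H A) (hinj : Function.Injective A)
    (T N : Finset W) (hNT : N ⊆ T) (hT : ∀ t ∈ T, (A t).card = 1) {n : ℕ} (g : Fin n → W)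
    (hg : Function.Injective g) (hpair : ∀ i, (A (g i)).card = 2)
    (hadj : ∀ i, ∀ t ∈ T, H.Adj t (g i) ↔ t ∈ N) : n ≤ (d - T.card).choose (2 - N.card) := by
  classical
  have h := hA.card_le_choose hinj T N hNT hT (Finset.univ.image g) (by simpa using hpair)
    (by simpa [H.adj_comm] using hadj)
  rwa [Finset.card_image_of_injective _ hg, Finset.card_univ, Fintype.card_fin] at h

/-- A vertex that misses some singleton of `T` cannot itself be a singleton. -/
theorem IsPairModel.le_choose (hA : IsPairModel H A) (hinj : Function.Injective A)
    (T N : Finset W) (hNT : N ⊆ T) (hne : ∃ t ∈ T, t ∉ N)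
    (hT : ∀ t ∈ T, (A t).card = 1) {n : ℕ} (g : Fin n → W)
    (hg : Function.Injective g) (hgT : ∀ i, g i ∉ T)
    (hadj : ∀ i, ∀ t ∈ T, H.Adj t (g i) ↔ t ∈ N) : n ≤ (d - T.card).choose (2 - N.card) := by
  refine hA.le_choose_of_pairs hinj T N hNT hT g hg (fun i => ?_) hadj
  obtain ⟨t, htT, htN⟩ := hne
  refine hA.card_eq_two_of_not_adj (fun h => hgT i (h ▸ htT)) (hT t htT) ?_
  rwa [hadj i t htT]

end Necessity

/-! ### The members of the forbidden family -/

section Families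

variable {d : ℕ}

/-- A graph with no injective pair model over `Fin d`. -/
def NoPairModel {W : Type*} (H : SimpleGraph W) (d : ℕ) : Prop :=
  ∀ A : W → Finset (Fin d), Function.Injective A → ¬ IsPairModel H A

/-- Every edge has a singleton end and singletons are pairwise adjacent. This alone excludes `2K_2`,
`C_4` and `C_5`, the obstructions to being a split graph. -/
theorem noPairModel_two_K2 : NoPairModel (K 2 ⊕g K 2) d := by
  intro A hinj hA
  obtain ⟨a, ha⟩ : ∃ a : Fin 2, (A (.inl a)).card = 1 :=
    (hA.card_eq_one_or_of_adj hinj (u := .inl 0) (v := .inl 1) (by simp)).elim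
      (fun h => ⟨_, h⟩) fun h => ⟨_, h⟩
  obtain ⟨b, hb⟩ : ∃ b : Fin 2, (A (.inr b)).card = 1 :=
    (hA.card_eq_one_or_of_adj hinj (u := .inr 0) (v := .inr 1) (by simp)).elim
      (fun h => ⟨_, h⟩) fun h => ⟨_, h⟩
  simpa using hA.adj_of_card_eq_one (by simp) ha hb

theorem attach_adj_inl_inl {V ι : Type*} (B : SimpleGraph V) (N : ι → Set V) (u v : V) :
    (attach B N).Adj (.inl u) (.inl v) ↔ B.Adj u v := Iff.rfl

theorem attach_adj_inl_inr {V ι : Type*} (B : SimpleGraph V) (N : ι → Set V) (u : V) (i : ι) :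
    (attach B N).Adj (.inl u) (.inr i) ↔ u ∈ N i := Iff.rfl

theorem attach_adj_inr_inl {V ι : Type*} (B : SimpleGraph V) (N : ι → Set V) (u : V) (i : ι) :
    (attach B N).Adj (.inr i) (.inl u) ↔ u ∈ N i := Iff.rfl

theorem attach_adj_inr_inr {V ι : Type*} (B : SimpleGraph V) (N : ι → Set V) (i j : ι) :
    (attach B N).Adj (.inr i) (.inr j) ↔ False := Iff.rfl

theorem noPairModel_cycleGraph_four : NoPairModel (cycleGraph 4) d := by
  intro A hinj hA
  have h01 := hA.card_eq_one_or_of_adj hinj (u := 0) (v := 1) (by decide)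
  have h12 := hA.card_eq_one_or_of_adj hinj (u := 1) (v := 2) (by decide)
  have h23 := hA.card_eq_one_or_of_adj hinj (u := 2) (v := 3) (by decide)
  have h30 := hA.card_eq_one_or_of_adj hinj (u := 3) (v := 0) (by decide)
  have h02 : ¬ ((A 0).card = 1 ∧ (A 2).card = 1) := fun h =>
    absurd (hA.adj_of_card_eq_one (by decide) h.1 h.2) (by decide)
  have h13 : ¬ ((A 1).card = 1 ∧ (A 3).card = 1) := fun h =>
    absurd (hA.adj_of_card_eq_one (by decide) h.1 h.2) (by decide)
  tauto

theorem noPairModel_cycleGraph_five : NoPairModel (cycleGraph 5) d := by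
  intro A hinj hA
  have hadj : ∀ i : Fin 5, (A i).card = 1 ∨ (A (i + 1)).card = 1 := fun i =>
    hA.card_eq_one_or_of_adj hinj (by revert i; decide)
  have hnadj : ∀ i : Fin 5, ¬ ((A i).card = 1 ∧ (A (i + 2)).card = 1) := fun i h =>
    absurd (hA.adj_of_card_eq_one (by clear h; revert i; decide) h.1 h.2)
      (by clear h; revert i; decide)
  have h0 := hadj 0
  have h1 := hadj 1
  have h2 := hadj 2
  have h3 := hadj 3
  have h4 := hadj 4
  have k0 := hnadj 0
  have k1 := hnadj 1
  have k2 := hnadj 2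
  have k3 := hnadj 3
  have k4 := hnadj 4
  simp only [Fin.reduceAdd] at *
  tauto

/-- The two joined vertices are singletons. Of the other three, at most one is a singleton because
they are nonadjacent, and at most one is a pair because only one pair contains both points. -/
theorem noPairModel_K23PlusEdge : NoPairModel K23PlusEdge d := by
  intro A hinj hA
  have h0 : (A (.inl 0)).card = 1 := hA.card_eq_one_of_adj₃ hinj (v₁ := .inr 0) (v₂ := .inr 1)
    (v₃ := .inr 2) (by simp [K23PlusEdge]) (by simp [K23PlusEdge]) (by simp [K23PlusEdge])
    (by simp) (by simp) (by simp)
  have h1 : (A (.inl 1)).card = 1 := hA.card_eq_one_of_adj₃ hinj (v₁ := .inr 0) (v₂ := .inr 1)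
    (v₃ := .inr 2) (by simp [K23PlusEdge]) (by simp [K23PlusEdge]) (by simp [K23PlusEdge])
    (by simp) (by simp) (by simp)
  have key : ∀ i j : Fin 3, i ≠ j → (A (.inr i)).card = 1 ∨ (A (.inr j)).card = 1 := by
    intro i j hij
    by_contra! h
    have hc := hA.card_le_choose hinj {.inl 0, .inl 1} {.inl 0, .inl 1} (Finset.Subset.refl _)
      (by simp [h0, h1]) {.inr i, .inr j}
      (by simp [(hA.card_eq_one_or_two _).resolve_left h.1,
        (hA.card_eq_one_or_two _).resolve_left h.2])
      (by simp [K23PlusEdge])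
    rw [Finset.card_pair (by simpa using hij), Finset.card_pair (by simp)] at hc
    simp at hc
  have hnadj : ∀ i j : Fin 3, i ≠ j → ¬ ((A (.inr i)).card = 1 ∧ (A (.inr j)).card = 1) := by
    intro i j hij h
    have := hA.adj_of_card_eq_one (by simpa using hij) h.1 h.2
    simp [K23PlusEdge, edge_adj] at this
  have h01 := key 0 1 (by decide)
  have h02 := key 0 2 (by decide)
  have h12 := key 1 2 (by decide)
  have k01 := hnadj 0 1 (by decide)
  have k02 := hnadj 0 2 (by decide)
  have k12 := hnadj 1 2 (by decide)
  tauto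

theorem noPairModel_K5MinusEdge : NoPairModel K5MinusEdge d := by
  intro A hinj hA
  have h0 : (A 0).card = 1 := hA.card_eq_one_of_adj₃ hinj (v₁ := 2) (v₂ := 3) (v₃ := 4)
    (by simp [K5MinusEdge]) (by simp [K5MinusEdge]) (by simp [K5MinusEdge])
    (by decide) (by decide) (by decide)
  have h1 : (A 1).card = 1 := hA.card_eq_one_of_adj₃ hinj (v₁ := 2) (v₂ := 3) (v₃ := 4)
    (by simp [K5MinusEdge]) (by simp [K5MinusEdge]) (by simp [K5MinusEdge])
    (by decide) (by decide) (by decide)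
  simpa [K5MinusEdge] using hA.adj_of_card_eq_one (by decide) h0 h1

/-- In every injective pair model of `B`, at least `k` vertices are represented by singletons. -/
def ForcesSingletons {W : Type*} (B : SimpleGraph W) (d k : ℕ) : Prop :=
  ∀ A : W → Finset (Fin d), Function.Injective A → IsPairModel B A →
    ∃ T : Finset W, T.card = k ∧ ∀ t ∈ T, (A t).card = 1

/-- The added vertices miss a singleton, so they are pairs among the remaining `d - k` points. For
`k = 0` they need not be pairs, which is why the edgeless graph is treated in
`noPairModel_edgeless`. -/
theorem ForcesSingletons.noPairModel_sum {W : Type*} {B : SimpleGraph W} {k : ℕ}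
    (h : ForcesSingletons B d k) (hk : 1 ≤ k) :
    NoPairModel (B ⊕g Kbar ((d - k).choose 2 + 1)) d := by
  intro A hinj hA
  obtain ⟨T, hTk, hT⟩ := h _ (hinj.comp (Embedding.sumInl (G := B)
    (H := Kbar ((d - k).choose 2 + 1))).injective) (hA.comp Embedding.sumInl)
  have hle := hA.le_choose hinj (T.map Function.Embedding.inl) ∅
    (Finset.empty_subset _) (by
      obtain ⟨t, ht⟩ := Finset.card_pos.1 (by omega : 0 < T.card)
      exact ⟨.inl t, by simpa using ht, by simp⟩)
    (by simpa using hT) Sum.inr Sum.inr_injective (by simp) (by simp)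
  rw [Finset.card_map, hTk, Finset.card_empty, Nat.sub_zero] at hle
  omega

theorem forcesSingletons_K2 : ForcesSingletons (K 2) d 1 := by
  intro A hinj hA
  rcases hA.card_eq_one_or_of_adj hinj (u := 0) (v := 1) (by simp) with h | h
  · exact ⟨{0}, rfl, by simpa using h⟩
  · exact ⟨{1}, rfl, by simpa using h⟩

theorem forcesSingletons_K3 : ForcesSingletons (K 3) d 2 := by
  intro A hinj hA
  have h01 := hA.card_eq_one_or_of_adj hinj (u := 0) (v := 1) (by simp)
  have h02 := hA.card_eq_one_or_of_adj hinj (u := 0) (v := 2) (by simp)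
  have h12 := hA.card_eq_one_or_of_adj hinj (u := 1) (v := 2) (by simp)
  have h : ((A 0).card = 1 ∧ (A 1).card = 1) ∨ ((A 0).card = 1 ∧ (A 2).card = 1) ∨
    ((A 1).card = 1 ∧ (A 2).card = 1) := by tauto
  rcases h with h | h | h
  · exact ⟨{0, 1}, rfl, by simpa using h⟩
  · exact ⟨{0, 2}, rfl, by simpa using h⟩
  · exact ⟨{1, 2}, rfl, by simpa using h⟩

theorem forcesSingletons_pathGraph_four : ForcesSingletons (pathGraph 4) d 2 := by
  intro A hinj hA
  have h01 := hA.card_eq_one_or_of_adj hinj (u := 0) (v := 1) (by simp [pathGraph_adj])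
  have h12 := hA.card_eq_one_or_of_adj hinj (u := 1) (v := 2) (by simp [pathGraph_adj])
  have h23 := hA.card_eq_one_or_of_adj hinj (u := 2) (v := 3) (by simp [pathGraph_adj])
  have h02 : ¬ ((A 0).card = 1 ∧ (A 2).card = 1) := fun h => by
    simpa [pathGraph_adj] using hA.adj_of_card_eq_one (by decide) h.1 h.2
  have h13 : ¬ ((A 1).card = 1 ∧ (A 3).card = 1) := fun h => by
    simpa [pathGraph_adj] using hA.adj_of_card_eq_one (by decide) h.1 h.2
  have h : (A 1).card = 1 ∧ (A 2).card = 1 := by tauto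
  exact ⟨{1, 2}, rfl, by simpa using h⟩

theorem IsPairModel.card_eq_one_of_complete {W : Type*} {H : SimpleGraph W}
    {A : W → Finset (Fin d)} (hA : IsPairModel H A) (hinj : Function.Injective A) {n : ℕ}
    (hn : 4 ≤ n) (f : K n ↪g H) (a : Fin n) : (A (f a)).card = 1 := by
  refine hA.card_eq_one_of_three_adj hinj ((Finset.univ.erase a).map f.toEmbedding) ?_ ?_
  · rw [Finset.card_map, Finset.card_erase_of_mem (Finset.mem_univ _), Finset.card_univ,
      Fintype.card_fin]
    omega
  · intro v hv
    obtain ⟨b, hb, rfl⟩ := Finset.mem_map.1 hv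
    exact f.map_adj_iff.2 (Finset.ne_of_mem_erase hb).symm

theorem forcesSingletons_K {n : ℕ} (hn : 4 ≤ n) : ForcesSingletons (K n) d n :=
  fun _ hinj hA => ⟨Finset.univ, by simp,
    fun t _ => hA.card_eq_one_of_complete hinj hn Embedding.refl t⟩

/-- The embedding of a graph into the graph that arises by attaching new vertices. -/
def attachInl {V ι : Type*} (B : SimpleGraph V) (N : ι → Set V) : B ↪g attach B N where
  toFun := Sum.inl
  inj' := Sum.inl_injective
  map_rel_iff' := Iff.rfl

theorem noPairModel_KPend {n : ℕ} (hn : 4 ≤ n) :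
    NoPairModel (KPend n (d + 1 - n)) d := by
  intro A hinj hA
  have hT : ∀ t ∈ Finset.univ.map (Function.Embedding.inl (α := Fin n) (β := Fin (d + 1 - n))),
      (A t).card = 1 := by
    intro t ht
    obtain ⟨a, -, rfl⟩ := Finset.mem_map.1 ht
    exact hA.card_eq_one_of_complete hinj hn (attachInl (K n) _) a
  -- This settles `n = d + 1`, where there are no pendant vertices: `d` points cannot carry `d + 1`
  -- distinct singletons. From here on `d + 1 - n` exceeds `d - n`.
  have hd : n ≤ d := by
    have h := card_le_dim ((Finset.univ.map
      (Function.Embedding.inl (α := Fin n) (β := Fin (d + 1 - n)))).biUnion A)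
    rw [card_biUnion_of_card_eq_one hinj _ hT] at h
    simpa using h
  have hle := hA.le_choose hinj _ {.inl ⟨0, by omega⟩} (by simp)
    ⟨.inl ⟨1, by omega⟩, by simp, by simp [Fin.ext_iff]⟩ hT Sum.inr Sum.inr_injective (by simp) (by
      intro i t ht
      obtain ⟨a, -, rfl⟩ := Finset.mem_map.1 ht
      simp [KPend, attach_adj_inl_inr, Fin.ext_iff])
  simp at hle
  omega

/-- The graph is a star with `d` leaves, and its centre is a singleton since `d ≥ 3`. If some leaf
is a singleton, the other `d - 1` are pairs through the centre avoiding it, and only `d - 2` exist;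
if none is, `d` pairs through one point are needed and only `d - 1` exist. -/
theorem noPairModel_star (hd : 3 ≤ d) : NoPairModel (KPend 2 (d - 1)) d := by
  intro A hinj hA
  have hadj : ∀ v, (KPend 2 (d - 1)).Adj (.inl 0) v ↔ v ≠ .inl 0 := by
    rintro (v | i)
    · simp [KPend, attach_adj_inl_inl, eq_comm]
    · simp [KPend, attach_adj_inl_inr]
  have hleaf : ∀ u v, u ≠ .inl 0 → v ≠ .inl 0 → ¬ (KPend 2 (d - 1)).Adj u v := by
    rintro (u | i) (v | j) hu hv
    · have hu' : u ≠ 0 := fun h => hu (by rw [h])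
      have hv' : v ≠ 0 := fun h => hv (by rw [h])
      simp [KPend, attach_adj_inl_inl]
      omega
    · have hu' : u ≠ 0 := fun h => hu (by rw [h])
      simpa [KPend, attach_adj_inl_inr] using hu'
    · have hv' : v ≠ 0 := fun h => hv (by rw [h])
      simpa [KPend, attach_adj_inr_inl] using hv'
    · simp [KPend, attach_adj_inr_inr]
  have hcard : (Finset.univ.erase (.inl 0) : Finset (Fin 2 ⊕ Fin (d - 1))).card = d := by
    rw [Finset.card_erase_of_mem (Finset.mem_univ _), Finset.card_univ, Fintype.card_sum,
      Fintype.card_fin, Fintype.card_fin]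
    omega
  have h0 : (A (.inl 0)).card = 1 :=
    hA.card_eq_one_of_three_adj hinj (Finset.univ.erase (.inl 0)) (by omega)
      fun v hv => (hadj v).2 (Finset.ne_of_mem_erase hv)
  by_cases hl : ∃ l, l ≠ .inl 0 ∧ (A l).card = 1
  · obtain ⟨l, hl, hl1⟩ := hl
    have hc := hA.card_le_choose hinj {.inl 0, l} {.inl 0} (by simp) (by simp [h0, hl1])
      ((Finset.univ.erase (.inl 0)).erase l)
      (fun m hm => by
        rw [Finset.mem_erase, Finset.mem_erase] at hm
        exact hA.card_eq_two_of_not_adj (Ne.symm hm.1) hl1 (hleaf _ _ hl hm.2.1))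
      (fun m hm t ht => by
        rw [Finset.mem_erase, Finset.mem_erase] at hm
        rw [Finset.mem_insert, Finset.mem_singleton] at ht
        rw [Finset.mem_singleton]
        rcases ht with rfl | rfl
        · exact iff_of_true ((hadj m).2 hm.2.1).symm rfl
        · exact iff_of_false (hleaf _ _ hm.2.1 hl) hl)
    rw [Finset.card_erase_of_mem (by simpa using hl), hcard, Finset.card_pair (Ne.symm hl)] at hc
    simp at hc
    omega
  · push Not at hl
    have hc := hA.card_le_choose hinj {.inl 0} {.inl 0} (Finset.Subset.refl _) (by simp [h0])
      (Finset.univ.erase (.inl 0))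
      (fun m hm => (hA.card_eq_one_or_two m).resolve_left (hl m (Finset.ne_of_mem_erase hm)))
      (fun m hm t ht => by
        rw [Finset.mem_singleton] at ht
        subst ht
        simpa using ((hadj m).2 (Finset.ne_of_mem_erase hm)).symm)
    rw [hcard] at hc
    simp at hc
    omega

theorem noPairModel_edgeless (hd : 3 ≤ d) : NoPairModel (K 0 ⊕g Kbar (d.choose 2 + 1)) d := by
  intro A hinj hA
  have hnadj : ∀ u v, ¬ (K 0 ⊕g Kbar (d.choose 2 + 1)).Adj u v := by
    rintro (u | i) (v | j)
    · exact u.elim0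
    · simp
    · simp
    · simp
  have hcard : (Finset.univ : Finset (Fin 0 ⊕ Fin (d.choose 2 + 1))).card = d.choose 2 + 1 := by
    simp
  by_cases hl : ∃ l, (A l).card = 1
  · obtain ⟨l, hl⟩ := hl
    have hc := hA.card_le_choose hinj {l} ∅ (by simp) (by simp [hl]) (Finset.univ.erase l)
      (fun m hm => hA.card_eq_two_of_not_adj (Finset.ne_of_mem_erase hm).symm hl (hnadj _ _))
      (fun m _ t _ => by simpa using hnadj m t)
    rw [Finset.card_erase_of_mem (Finset.mem_univ _), hcard] at hc
    -- By Pascal's rule `d.choose 2` exceeds `(d - 1).choose 2` by `d - 1 > 0`, so one singleton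
    -- costs more pairs than it replaces.
    obtain ⟨e, rfl⟩ := Nat.exists_eq_add_of_le hd
    have : (3 + e).choose 2 = (2 + e).choose 1 + (2 + e).choose 2 := by
      rw [show 3 + e = (2 + e) + 1 by ring, Nat.choose_succ_succ]
    rw [Nat.choose_one_right] at this
    simp only [Finset.card_singleton, Finset.card_empty, Nat.sub_zero, Nat.add_sub_cancel] at hc
    rw [show 3 + e - 1 = 2 + e by omega] at hc
    omega
  · push Not at hl
    have hc := hA.card_le_choose hinj ∅ ∅ (by simp) (by simp) Finset.univ
      (fun m _ => (hA.card_eq_one_or_two m).resolve_left (hl m)) (by simp)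
    rw [hcard] at hc
    simp at hc

/-- Each vertex of the triangle has a third neighbour; at vertex `0` it is a pendant vertex, which
needs `s ≥ 1`. -/
theorem IsPairModel.K3Pend1_card_eq_one {s : ℕ} (hs : 1 ≤ s)
    {A : Fin 3 ⊕ (Fin s ⊕ Fin 1) → Finset (Fin d)} (hinj : Function.Injective A)
    (hA : IsPairModel (K3Pend1 s) A) (t : Fin 3) : (A (.inl t)).card = 1 := by
  fin_cases t
  · exact hA.card_eq_one_of_adj₃ hinj (v₁ := .inl 1) (v₂ := .inl 2) (v₃ := .inr (.inl ⟨0, hs⟩))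
      (by simp [K3Pend1, attach_adj_inl_inl]) (by simp [K3Pend1, attach_adj_inl_inl])
      (by simp [K3Pend1, attach_adj_inl_inr]) (by simp) (by simp) (by simp)
  · exact hA.card_eq_one_of_adj₃ hinj (v₁ := .inl 0) (v₂ := .inl 2) (v₃ := .inr (.inr 0))
      (by simp [K3Pend1, attach_adj_inl_inl]) (by simp [K3Pend1, attach_adj_inl_inl])
      (by simp [K3Pend1, attach_adj_inl_inr]) (by simp) (by simp) (by simp)
  · exact hA.card_eq_one_of_adj₃ hinj (v₁ := .inl 0) (v₂ := .inl 1) (v₃ := .inr (.inr 0))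
      (by simp [K3Pend1, attach_adj_inl_inl]) (by simp [K3Pend1, attach_adj_inl_inl])
      (by simp [K3Pend1, attach_adj_inl_inr]) (by simp) (by simp) (by simp)

theorem IsPairModel.K3Pend11_card_eq_one {s : ℕ} (hs : 1 ≤ s)
    {A : Fin 3 ⊕ (Fin s ⊕ Fin 2) → Finset (Fin d)} (hinj : Function.Injective A)
    (hA : IsPairModel (K3Pend11 s) A) (t : Fin 3) : (A (.inl t)).card = 1 := by
  fin_cases t
  · exact hA.card_eq_one_of_adj₃ hinj (v₁ := .inl 1) (v₂ := .inl 2) (v₃ := .inr (.inl ⟨0, hs⟩))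
      (by simp [K3Pend11, attach_adj_inl_inl]) (by simp [K3Pend11, attach_adj_inl_inl])
      (by simp [K3Pend11, attach_adj_inl_inr]) (by simp) (by simp) (by simp)
  · exact hA.card_eq_one_of_adj₃ hinj (v₁ := .inl 0) (v₂ := .inl 2) (v₃ := .inr (.inr 0))
      (by simp [K3Pend11, attach_adj_inl_inl]) (by simp [K3Pend11, attach_adj_inl_inl])
      (by simp [K3Pend11, attach_adj_inl_inr]) (by simp) (by simp) (by simp)
  · exact hA.card_eq_one_of_adj₃ hinj (v₁ := .inl 0) (v₂ := .inl 1) (v₃ := .inr (.inr 1))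
      (by simp [K3Pend11, attach_adj_inl_inl]) (by simp [K3Pend11, attach_adj_inl_inl])
      (by simp [K3Pend11, attach_adj_inl_inr]) (by simp) (by simp) (by simp)

theorem forcesSingletons_K3Pend1 {s : ℕ} (hs : 1 ≤ s) : ForcesSingletons (K3Pend1 s) d 3 :=
  fun _ hinj hA => ⟨Finset.univ.map Function.Embedding.inl, by simp, by
    simpa using fun t => hA.K3Pend1_card_eq_one hs hinj t⟩

theorem forcesSingletons_K3Pend11 {s : ℕ} (hs : 1 ≤ s) : ForcesSingletons (K3Pend11 s) d 3 :=
  fun _ hinj hA => ⟨Finset.univ.map Function.Embedding.inl, by simp, by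
    simpa using fun t => hA.K3Pend11_card_eq_one hs hinj t⟩

/-- The pendant vertices are pairs through one of three singletons that avoid the other two, so
there are at most `d - 3` of them. -/
theorem noPairModel_K3Pend1 (hd : 3 ≤ d) : NoPairModel (K3Pend1 (d - 2)) d := by
  intro A hinj hA
  have hle := hA.le_choose hinj (Finset.univ.map Function.Embedding.inl) {.inl 0}
    (by simp) ⟨.inl 1, by simp, by simp⟩
    (by simpa using fun t => hA.K3Pend1_card_eq_one (by omega) hinj t)
    (Sum.inr ∘ Sum.inl) (Sum.inr_injective.comp Sum.inl_injective) (by simp)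
    (by simp [K3Pend1, attach_adj_inl_inr])
  simp at hle
  omega

theorem noPairModel_K3Pend11 (hd : 3 ≤ d) : NoPairModel (K3Pend11 (d - 2)) d := by
  intro A hinj hA
  have hle := hA.le_choose hinj (Finset.univ.map Function.Embedding.inl) {.inl 0}
    (by simp) ⟨.inl 1, by simp, by simp⟩
    (by simpa using fun t => hA.K3Pend11_card_eq_one (by omega) hinj t)
    (Sum.inr ∘ Sum.inl) (Sum.inr_injective.comp Sum.inl_injective) (by simp)
    (by simp [K3Pend11, attach_adj_inl_inr])
  simp at hle
  omega

/-- The vertices of degree three are singletons. Were both others pairs, each would consist of the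
points of these two singletons, against injectivity. -/
theorem IsPairModel.K4MinusEdge_card_eq_one {W : Type*} {H : SimpleGraph W}
    {A : W → Finset (Fin d)} (hA : IsPairModel H A) (hinj : Function.Injective A)
    (f : K4MinusEdge ↪g H) : (A (f 2)).card = 1 ∧ (A (f 3)).card = 1 ∧
      ((A (f 0)).card = 1 ∨ (A (f 1)).card = 1) := by
  have hne : ∀ i j : Fin 4, i ≠ j → f i ≠ f j := fun i j h => f.injective.ne h
  have hadj : ∀ i j : Fin 4, K4MinusEdge.Adj i j → H.Adj (f i) (f j) := fun _ _ => f.map_adj_iff.2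
  have h2 : (A (f 2)).card = 1 :=
    hA.card_eq_one_of_adj₃ hinj (v₁ := f 0) (v₂ := f 1) (v₃ := f 3)
      (hadj _ _ (by simp [K4MinusEdge])) (hadj _ _ (by simp [K4MinusEdge]))
      (hadj _ _ (by simp [K4MinusEdge]))
      (hne _ _ (by decide)) (hne _ _ (by decide)) (hne _ _ (by decide))
  have h3 : (A (f 3)).card = 1 :=
    hA.card_eq_one_of_adj₃ hinj (v₁ := f 0) (v₂ := f 1) (v₃ := f 2)
      (hadj _ _ (by simp [K4MinusEdge])) (hadj _ _ (by simp [K4MinusEdge]))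
      (hadj _ _ (by simp [K4MinusEdge]))
      (hne _ _ (by decide)) (hne _ _ (by decide)) (hne _ _ (by decide))
  refine ⟨h2, h3, ?_⟩
  classical
  by_contra! h
  have hc := hA.card_le_choose hinj {f 2, f 3} {f 2, f 3} (Finset.Subset.refl _)
    (by simp [h2, h3]) {f 0, f 1}
    (by simp [(hA.card_eq_one_or_two _).resolve_left h.1,
      (hA.card_eq_one_or_two _).resolve_left h.2])
    (by
      have h02 := hadj 0 2 (by simp [K4MinusEdge])
      have h03 := hadj 0 3 (by simp [K4MinusEdge])
      have h12 := hadj 1 2 (by simp [K4MinusEdge])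
      have h13 := hadj 1 3 (by simp [K4MinusEdge])
      simp [h02, h03, h12, h13])
  rw [Finset.card_pair (hne _ _ (by decide)), Finset.card_pair (hne _ _ (by decide))] at hc
  simp at hc

theorem forcesSingletons_K4MinusEdge : ForcesSingletons K4MinusEdge d 3 := by
  intro A hinj hA
  obtain ⟨h2, h3, h | h⟩ := hA.K4MinusEdge_card_eq_one hinj Embedding.refl
  · exact ⟨{0, 2, 3}, rfl, by simpa using ⟨h, h2, h3⟩⟩
  · exact ⟨{1, 2, 3}, rfl, by simpa using ⟨h, h2, h3⟩⟩

theorem noPairModel_K4MinusEdgePend (hd : 3 ≤ d) : NoPairModel (K4MinusEdgePend (d - 2)) d := by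
  intro A hinj hA
  obtain ⟨h2, h3, h⟩ := hA.K4MinusEdge_card_eq_one hinj (attachInl K4MinusEdge _)
  have key : ∀ c : Fin 4, c ≠ 2 → c ≠ 3 → ¬ (A (.inl c)).card = 1 := by
    intro c hc2 hc3 hc
    have hle := hA.le_choose hinj {.inl 2, .inl 3, .inl c} {.inl 2} (by simp) ⟨.inl 3, by simp, by simp⟩
      (by simpa using ⟨h2, h3, hc⟩) Sum.inr Sum.inr_injective (by simp)
      (by simp [K4MinusEdgePend, attach_adj_inl_inr, hc2])
    rw [Finset.card_eq_three.2 ⟨_, _, _, by simp, by simpa using hc2.symm, by simpa using hc3.symm,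
      rfl⟩] at hle
    simp at hle
    omega
  rcases h with h | h
  · exact key 0 (by decide) (by decide) h
  · exact key 1 (by decide) (by decide) h

theorem noPairModel_of_mem_forbiddenFamily (hd : 3 ≤ d) :
    ∀ F ∈ forbiddenFamily d, NoPairModel F.2 d := by
  rintro F ((((((rfl | rfl | rfl | rfl | rfl) | (rfl | rfl | rfl)) | ⟨i, hi, rfl⟩) |
    (rfl | rfl | rfl)) | (rfl | rfl | rfl)) | ⟨i, hi, rfl⟩)
  · exact noPairModel_two_K2
  · exact noPairModel_cycleGraph_four
  · exact noPairModel_cycleGraph_five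
  · exact noPairModel_K23PlusEdge
  · exact noPairModel_K5MinusEdge
  · exact noPairModel_K3Pend1 hd
  · exact noPairModel_K3Pend11 hd
  · exact noPairModel_K4MinusEdgePend hd
  · rcases hi with rfl | hi
    · exact noPairModel_star hd
    · exact noPairModel_KPend hi.1
  · exact forcesSingletons_K2.noPairModel_sum le_rfl
  · exact forcesSingletons_K3.noPairModel_sum (by omega)
  · exact forcesSingletons_pathGraph_four.noPairModel_sum (by omega)
  · exact (forcesSingletons_K3Pend1 le_rfl).noPairModel_sum (by omega)
  · exact (forcesSingletons_K3Pend11 le_rfl).noPairModel_sum (by omega)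
  · exact forcesSingletons_K4MinusEdge.noPairModel_sum (by omega)
  · rcases hi with rfl | hi
    · exact noPairModel_edgeless hd
    · exact (forcesSingletons_K hi.1).noPairModel_sum (by omega)

theorem forb_of_isPairModel {W : Type*} {H : SimpleGraph W} (hd : 3 ≤ d)
    {A : W → Finset (Fin d)} (hinj : Function.Injective A) (hA : IsPairModel H A) :
    Forb (forbiddenFamily d) H :=
  fun F hF ⟨f⟩ =>
    noPairModel_of_mem_forbiddenFamily hd F hF _ (hinj.comp f.injective) (hA.comp f)

end Families

/-! ### Construction of pair models -/

theorem exists_injOn_of_card_le {α β : Type*} [Nonempty β] (s : Finset α) (t : Finset β)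
    (h : s.card ≤ t.card) : ∃ f : α → β, (∀ x ∈ s, f x ∈ t) ∧ Set.InjOn f s := by
  classical
  obtain ⟨t', ht, hc⟩ := Finset.exists_subset_card_eq h
  let e := Finset.equivOfCardEq hc.symm
  refine ⟨fun x => if hx : x ∈ s then (e ⟨x, hx⟩).1 else Classical.arbitrary β,
    fun x hx => ?_, fun x hx y hy hxy => ?_⟩
  · simp only [hx, dif_pos]
    exact ht (e _).2
  · rw [Finset.mem_coe] at hx hy
    simp only [hx, hy, dif_pos] at hxy
    exact congrArg Subtype.val (e.injective (Subtype.ext hxy))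

section Construction

variable {W : Type*} {H : SimpleGraph W} {d : ℕ}

open Classical in
-- The vertices of `C` become distinct singletons, and a vertex outside `C` becomes the points of
-- its neighbours in `C` completed to a pair by unused points. The last four hypotheses say that no
-- neighbourhood in `C` occurs more often than it has completions.
theorem exists_isPairModel_of_split [Fintype W] (hd : 3 ≤ d) (C : Finset W)
    (hC : C.card ≤ d)
    (hclique : ∀ u ∈ C, ∀ v ∈ C, u ≠ v → H.Adj u v)
    (hindep : ∀ u, u ∉ C → ∀ v, v ∉ C → ¬ H.Adj u v)
    (h3 : ∀ v, v ∉ C → ∀ S ⊆ C, (∀ s ∈ S, H.Adj v s) → S.card ≤ 2)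
    (h2 : ∀ u v, u ∉ C → v ∉ C → u ≠ v → ∀ a ∈ C, ∀ b ∈ C, a ≠ b →
      H.Adj u a → H.Adj u b → H.Adj v a → H.Adj v b → False)
    (h1 : ∀ a ∈ C, ∀ M : Finset W, (∀ v ∈ M, v ∉ C) →
      (∀ v ∈ M, ∀ c ∈ C, H.Adj v c ↔ c = a) → M.card ≤ d - C.card)
    (h0 : ∀ M : Finset W, (∀ v ∈ M, v ∉ C) →
      (∀ v ∈ M, ∀ c ∈ C, ¬ H.Adj v c) → M.card ≤ (d - C.card).choose 2) :
    ∃ A : W → Finset (Fin d), Function.Injective A ∧ IsPairModel H A := by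
  have : Nonempty (Fin d) := ⟨⟨0, by omega⟩⟩
  let N : W → Finset W := fun v => C.filter (H.Adj v)
  have hN : ∀ v c, c ∈ N v ↔ c ∈ C ∧ H.Adj v c := fun v c => Finset.mem_filter
  have hNC : ∀ v, N v ⊆ C := fun v => Finset.filter_subset _ _
  have hN2 : ∀ v, v ∉ C → (N v).card ≤ 2 := fun v hv =>
    h3 v hv _ (hNC v) fun s hs => ((hN v s).1 hs).2
  -- Only an `S` that occurs as a neighbourhood matters, and `h3` bounds its order by two; the
  -- orders 0, 1, 2 are `h0`, `h1`, `h2`.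
  have hfib : ∀ S : Finset W, (Finset.univ.filter fun v => v ∉ C ∧ N v = S).card ≤
      (d - C.card).choose (2 - S.card) := by
    intro S
    rcases Finset.eq_empty_or_nonempty (Finset.univ.filter fun v => v ∉ C ∧ N v = S) with
      he | ⟨w, hw⟩
    · rw [he]
      exact Nat.zero_le _
    obtain ⟨hwC, rfl⟩ := (Finset.mem_filter.1 hw).2
    have hm : ∀ v ∈ Finset.univ.filter (fun v => v ∉ C ∧ N v = N w), v ∉ C ∧ N v = N w :=
      fun v hv => (Finset.mem_filter.1 hv).2
    have hcases : (N w).card = 0 ∨ (N w).card = 1 ∨ (N w).card = 2 := by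
      have := hN2 w hwC
      omega
    rcases hcases with hc | hc | hc
    · rw [hc]
      refine h0 _ (fun v hv => (hm v hv).1) fun v hv c hcC hvc => ?_
      have : c ∈ N w := (hm v hv).2 ▸ (hN v c).2 ⟨hcC, hvc⟩
      rw [Finset.card_eq_zero.1 hc] at this
      simp at this
    · rw [hc, Nat.choose_one_right]
      obtain ⟨a, ha⟩ := Finset.card_eq_one.1 hc
      refine h1 a (hNC w (by simp [ha])) _ (fun v hv => (hm v hv).1) fun v hv c hcC => ?_
      rw [← Finset.mem_singleton, ← ha, ← (hm v hv).2, hN]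
      exact (and_iff_right hcC).symm
    · rw [hc, Nat.choose_zero_right, Finset.card_le_one]
      obtain ⟨a, b, hab, hw2⟩ := Finset.card_eq_two.1 hc
      intro u hu v hv
      by_contra huv
      have hua : ∀ u ∈ Finset.univ.filter (fun v => v ∉ C ∧ N v = N w), ∀ c ∈ N w, H.Adj u c :=
        fun u hu c hc => ((hN u c).1 ((hm u hu).2 ▸ hc)).2
      exact h2 u v (hm u hu).1 (hm v hv).1 huv a (hNC w (by simp [hw2])) b
        (hNC w (by simp [hw2])) hab (hua u hu a (by simp [hw2])) (hua u hu b (by simp [hw2]))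
        (hua v hv a (by simp [hw2])) (hua v hv b (by simp [hw2]))
  obtain ⟨g, -, hg⟩ := exists_injOn_of_card_le C (Finset.univ : Finset (Fin d)) (by simpa using hC)
  have hcardX : ((C.image g)ᶜ).card = d - C.card := by
    rw [Finset.card_compl, Fintype.card_fin, Finset.card_image_of_injOn hg]
  -- The completions are chosen injectively within each neighbourhood class; across classes the
  -- pairs already differ on the points of `C`.
  have he : ∀ S : Finset W, ∃ e : W → Finset (Fin d),
      (∀ v ∈ Finset.univ.filter (fun v => v ∉ C ∧ N v = S),
        e v ∈ ((C.image g)ᶜ).powersetCard (2 - S.card)) ∧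
      Set.InjOn e (Finset.univ.filter fun v => v ∉ C ∧ N v = S) := fun S =>
    exists_injOn_of_card_le _ _ (by
      rw [Finset.card_powersetCard, hcardX]
      exact hfib S)
  choose e he hinj using he
  have he' : ∀ v, v ∉ C → e (N v) v ⊆ (C.image g)ᶜ ∧ (e (N v) v).card = 2 - (N v).card :=
    fun v hv => Finset.mem_powersetCard.1 (he (N v) v (by simp [hv]))
  let A : W → Finset (Fin d) := fun v => if v ∈ C then {g v} else (N v).image g ∪ e (N v) v
  have hA1 : ∀ v, v ∈ C → A v = {g v} := fun v hv => if_pos hv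
  have hA2 : ∀ v, v ∉ C → A v = (N v).image g ∪ e (N v) v := fun v hv => if_neg hv
  have hc2 : ∀ v, v ∉ C → (A v).card = 2 := by
    intro v hv
    rw [hA2 v hv, Finset.card_union_of_disjoint, Finset.card_image_of_injOn (hg.mono (hNC v)),
      (he' v hv).2]
    · have := hN2 v hv
      omega
    · refine Finset.disjoint_of_subset_left (Finset.image_subset_image (hNC v)) ?_
      exact Finset.disjoint_of_subset_right (he' v hv).1 disjoint_compl_right
  have hmem : ∀ v, v ∉ C → ∀ c ∈ C, (g c ∈ A v ↔ H.Adj v c) := by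
    intro v hv c hc
    rw [hA2 v hv, Finset.mem_union, or_iff_left, Finset.mem_image]
    · constructor
      · rintro ⟨b, hb, hbc⟩
        rw [← hg (hNC v hb) hc hbc]
        exact ((hN v b).1 hb).2
      · intro h
        exact ⟨c, (hN v c).2 ⟨hc, h⟩, rfl⟩
    · intro h
      exact Finset.mem_compl.1 ((he' v hv).1 h) (Finset.mem_image_of_mem g hc)
  have hinjA : ∀ u v, u ∉ C → v ∉ C → A u = A v → u = v := by
    intro u v hu hv h
    have hNN : N u = N v := by
      ext c
      rw [hN, hN]
      exact and_congr_right fun hc => by rw [← hmem u hu c hc, ← hmem v hv c hc, h]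
    have hsd : ∀ w, w ∉ C → A w \ C.image g = e (N w) w := by
      intro w hw
      rw [hA2 w hw, Finset.union_sdiff_distrib,
        Finset.sdiff_eq_empty_iff_subset.2 (Finset.image_subset_image (hNC w)),
        Finset.empty_union, Finset.sdiff_eq_self_iff_disjoint]
      exact Finset.disjoint_of_subset_left (he' w hw).1 disjoint_compl_left
    refine hinj (N u) (by simp [hu]) (by simp [hv, hNN]) ?_
    have h1 := hsd u hu
    rw [h, hsd v hv, ← hNN] at h1
    exact h1.symm
  have hmixed : ∀ u v, u ∉ C → v ∈ C → (H.Adj u v ↔ (A u ∪ A v).card ≤ 2) := by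
    intro u v hu hv
    rw [← hmem u hu v hv, hA1 v hv]
    constructor
    · intro h
      rw [Finset.union_eq_left.2 (Finset.singleton_subset_iff.2 h), hc2 u hu]
    · intro h
      have := Finset.eq_of_subset_of_card_le
        (Finset.subset_union_left (s₁ := A u) (s₂ := {g v})) (by rw [hc2 u hu]; exact h)
      rw [this]
      simp
  refine ⟨A, fun u v h => ?_, fun u => ?_, fun u => ?_, fun u v huv => ?_⟩
  · by_cases hu : u ∈ C <;> by_cases hv : v ∈ C
    · rw [hA1 u hu, hA1 v hv, Finset.singleton_inj] at h
      exact hg hu hv h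
    · have := hc2 v hv
      rw [← h, hA1 u hu] at this
      simp at this
    · have := hc2 u hu
      rw [h, hA1 v hv] at this
      simp at this
    · exact hinjA u v hu hv h
  · by_cases hu : u ∈ C
    · simp [hA1 u hu]
    · simp [hc2 u hu]
  · by_cases hu : u ∈ C
    · simp [hA1 u hu]
    · simp [hc2 u hu]
  · by_cases hu : u ∈ C <;> by_cases hv : v ∈ C
    · rw [hA1 u hu, hA1 v hv]
      exact iff_of_true (hclique u hu v hv huv) (Finset.card_union_le _ _)
    · rw [H.adj_comm, Finset.union_comm]
      exact hmixed v u hv hu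
    · exact hmixed u v hu hv
    · refine iff_of_false (hindep u hu v hv) fun h => huv (hinjA u v hu hv ?_)
      have h1 := Finset.eq_of_subset_of_card_le
        (Finset.subset_union_left (s₁ := A u) (s₂ := A v)) (by rw [hc2 u hu]; exact h)
      have h2 := Finset.eq_of_subset_of_card_le
        (Finset.subset_union_right (s₁ := A u) (s₂ := A v)) (by rw [hc2 v hv]; exact h)
      rw [h1, ← h2]

end Construction

/-! ### Induced subgraphs -/

section Induced

variable {W : Type*} {H : SimpleGraph W} {d : ℕ}

theorem exists_embedding_of_fin {n : ℕ} {B : SimpleGraph (Fin n)} (f : Fin n → W)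
    (hne : ∀ i j, i < j → f i ≠ f j) (hadj : ∀ i j, i < j → (H.Adj (f i) (f j) ↔ B.Adj i j)) :
    ∃ φ : B ↪g H, ⇑φ = f := by
  refine ⟨⟨⟨f, fun i j h => ?_⟩, fun {i j} => ?_⟩, rfl⟩
  · rcases lt_trichotomy i j with hij | hij | hij
    · exact absurd h (hne _ _ hij)
    · exact hij
    · exact absurd h.symm (hne _ _ hij)
  · change H.Adj (f i) (f j) ↔ _
    rcases lt_trichotomy i j with hij | rfl | hij
    · exact hadj _ _ hij
    · simp
    · rw [H.adj_comm, B.adj_comm]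
      exact hadj _ _ hij

theorem exists_embedding_attach {V ι : Type*} {B : SimpleGraph V} {N : ι → Set V} (f : B ↪g H)
    (g : ι → W) (hg : Function.Injective g) (hindep : ∀ i j, ¬ H.Adj (g i) (g j))
    (hne : ∀ u i, f u ≠ g i) (hadj : ∀ u i, H.Adj (f u) (g i) ↔ u ∈ N i) :
    ∃ φ : attach B N ↪g H, ⇑φ = Sum.elim f g := by
  refine ⟨⟨⟨Sum.elim f g, f.injective.sumElim hg hne⟩, ?_⟩, rfl⟩
  rintro (u | i) (v | j)
  · exact f.map_adj_iff
  · exact hadj u j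
  · rw [SimpleGraph.adj_comm]
    exact hadj v i
  · exact iff_of_false (hindep i j) id

theorem attach_isIndContained {V ι : Type*} {B : SimpleGraph V} {N : ι → Set V} (f : B ↪g H)
    (g : ι → W) (hg : Function.Injective g) (hindep : ∀ i j, ¬ H.Adj (g i) (g j))
    (hne : ∀ u i, f u ≠ g i) (hadj : ∀ u i, H.Adj (f u) (g i) ↔ u ∈ N i) :
    (attach B N).IsIndContained H :=
  let ⟨φ, _⟩ := exists_embedding_attach f g hg hindep hne hadj
  ⟨φ⟩

theorem sum_Kbar_isIndContained {V : Type*} {B : SimpleGraph V} {n : ℕ} (f : B ↪g H)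
    (g : Fin n → W) (hg : Function.Injective g) (hindep : ∀ i j, ¬ H.Adj (g i) (g j))
    (hne : ∀ u i, f u ≠ g i) (hadj : ∀ u i, ¬ H.Adj (f u) (g i)) :
    (B ⊕g Kbar n).IsIndContained H := by
  refine ⟨⟨⟨Sum.elim f g, f.injective.sumElim hg hne⟩, ?_⟩⟩
  rintro (u | i) (v | j)
  · simp
  · simpa using hadj u j
  · simpa [H.adj_comm] using hadj v i
  · simpa using hindep i j

theorem exists_injective_fin {n : ℕ} (M : Finset W) (h : n ≤ M.card) :
    ∃ g : Fin n → W, Function.Injective g ∧ ∀ i, g i ∈ M :=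
  ⟨fun i => M.equivFin.symm (Fin.castLE h i), fun i j hij => by
    simpa using hij, fun i => (M.equivFin.symm (Fin.castLE h i)).2⟩

/-- The prescribed vertex goes to `0` because that is where `KPend` carries its pendant vertices. -/
theorem exists_embedding_K {n : ℕ} (C : Finset W) (hC : ∀ u ∈ C, ∀ v ∈ C, u ≠ v → H.Adj u v)
    (hn : C.card = n) (hpos : 0 < n) {a : W} (ha : a ∈ C) :
    ∃ f : K n ↪g H, (∀ i, f i ∈ C) ∧ f ⟨0, hpos⟩ = a := by
  let e : Fin n ≃ C := (C.equivFinOfCardEq hn).symm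
  let e' : Fin n ≃ C := (Equiv.swap ⟨0, hpos⟩ (e.symm ⟨a, ha⟩)).trans e
  have hinj : Function.Injective fun i => (e' i).1 := Subtype.val_injective.comp e'.injective
  refine ⟨⟨⟨fun i => (e' i).1, hinj⟩, fun {i j} => ?_⟩, fun i => (e' i).2, ?_⟩
  · constructor
    · rintro h rfl
      exact H.loopless.irrefl _ h
    · intro h
      exact hC _ (e' i).2 _ (e' j).2 (hinj.ne h)
  · change (e' ⟨0, hpos⟩).1 = a
    simp [e']

end Induced

/-! ### Consequences of the absence of forbidden induced subgraphs -/

section Forbidden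

variable {W : Type*} {H : SimpleGraph W} {d : ℕ}

theorem Forb.no_two_K2 (F : Forb (forbiddenFamily d) H) {a b x y : W} (hab : H.Adj a b)
    (hxy : H.Adj x y) (hax : ¬ H.Adj a x) (hay : ¬ H.Adj a y) (hbx : ¬ H.Adj b x)
    (hby : ¬ H.Adj b y) : False := by
  obtain ⟨f, hf⟩ := exists_embedding_of_fin (H := H) (B := K 2) ![a, b]
    (by simp [Fin.forall_fin_succ, hab.ne]) (by simp [Fin.forall_fin_succ, hab])
  obtain ⟨g, hg⟩ := exists_embedding_of_fin (H := H) (B := K 2) ![x, y]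
    (by simp [Fin.forall_fin_succ, hxy.ne]) (by simp [Fin.forall_fin_succ, hxy])
  have hnadj : ∀ i j, ¬ H.Adj (f i) (g j) := by
    simp [hf, hg, Fin.forall_fin_succ, hax, hay, hbx, hby]
  -- A common vertex of the two edges would be adjacent to the other end of the second edge.
  have hne : ∀ i j, f i ≠ g j := by
    intro i j h
    obtain ⟨k, hk⟩ := exists_ne j
    exact hnadj i k (h ▸ g.map_adj_iff.2 hk.symm)
  refine F ⟨_, K 2 ⊕g K 2⟩ (by simp [forbiddenFamily])
    ⟨⟨⟨Sum.elim f g, f.injective.sumElim g.injective hne⟩, ?_⟩⟩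
  rintro (u | i) (v | j)
  · simp
  · simpa using hnadj u j
  · simpa [H.adj_comm] using hnadj v i
  · simp

theorem Forb.no_C4 (F : Forb (forbiddenFamily d) H) {a b x y : W} (hab : H.Adj a b)
    (hbx : H.Adj b x) (hxy : H.Adj x y) (hya : H.Adj y a) (hax : ¬ H.Adj a x) (hby : ¬ H.Adj b y)
    (hax' : a ≠ x) (hby' : b ≠ y) : False := by
  obtain ⟨f, -⟩ := exists_embedding_of_fin (H := H) (B := cycleGraph 4) ![a, b, x, y]
    (by simp [Fin.forall_fin_succ, hab.ne, hbx.ne, hxy.ne, hya.ne', hax', hby'])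
    (by simp [Fin.forall_fin_succ, hab, hbx, hxy, hya.symm, hax, hby]; decide)
  exact F ⟨_, cycleGraph 4⟩ (by simp [forbiddenFamily]) ⟨f⟩

theorem Forb.no_C5 (F : Forb (forbiddenFamily d) H) {a b x y z : W} (hab : H.Adj a b)
    (hbx : H.Adj b x) (hxy : H.Adj x y) (hyz : H.Adj y z) (hza : H.Adj z a) (hax : ¬ H.Adj a x)
    (hay : ¬ H.Adj a y) (hby : ¬ H.Adj b y) (hbz : ¬ H.Adj b z) (hxz : ¬ H.Adj x z) : False := by
  have hax' : a ≠ x := by rintro rfl; exact hay hxy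
  have hay' : a ≠ y := by rintro rfl; exact hax hxy.symm
  have hby' : b ≠ y := by rintro rfl; exact hbz hyz
  have hbz' : b ≠ z := by rintro rfl; exact hby hyz.symm
  have hxz' : x ≠ z := by rintro rfl; exact hax hza.symm
  obtain ⟨f, -⟩ := exists_embedding_of_fin (H := H) (B := cycleGraph 5) ![a, b, x, y, z]
    (by simp [Fin.forall_fin_succ, hab.ne, hbx.ne, hxy.ne, hyz.ne, hza.ne', hax', hay', hby', hbz',
      hxz'])
    (by simp [Fin.forall_fin_succ, hab, hbx, hxy, hyz, hza.symm, hax, hay, hby, hbz, hxz]; decide)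
  exact F ⟨_, cycleGraph 5⟩ (by simp [forbiddenFamily]) ⟨f⟩

theorem Forb.no_K23PlusEdge (F : Forb (forbiddenFamily d) H) {a b x y z : W} (hab : H.Adj a b)
    (hax : H.Adj a x) (hay : H.Adj a y) (haz : H.Adj a z) (hbx : H.Adj b x) (hby : H.Adj b y)
    (hbz : H.Adj b z) (hxy : ¬ H.Adj x y) (hxz : ¬ H.Adj x z) (hyz : ¬ H.Adj y z) (hxy' : x ≠ y)
    (hxz' : x ≠ z) (hyz' : y ≠ z) : False := by
  have hinj : Function.Injective (Sum.elim ![a, b] ![x, y, z]) := by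
    refine Function.Injective.sumElim ?_ ?_ ?_
    · intro i j
      fin_cases i <;> fin_cases j <;> simp [hab.ne, hab.ne']
    · intro i j
      fin_cases i <;> fin_cases j <;> simp [hxy', hxz', hyz', hxy'.symm, hxz'.symm, hyz'.symm]
    · simp [Fin.forall_fin_succ, hax.ne, hay.ne, haz.ne, hbx.ne, hby.ne, hbz.ne]
  refine F ⟨_, K23PlusEdge⟩ (by simp [forbiddenFamily]) ⟨⟨⟨_, hinj⟩, ?_⟩⟩
  rintro (i | i) (j | j) <;> fin_cases i <;> fin_cases j <;>
    simp [K23PlusEdge, edge_adj, hab, hax, hay, haz, hbx, hby, hbz, hxy, hxz, hyz, H.adj_comm]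

theorem Forb.no_K5MinusEdge (F : Forb (forbiddenFamily d) H) {a b c x y : W} (hab : H.Adj a b)
    (hac : H.Adj a c) (hbc : H.Adj b c) (hxa : H.Adj x a) (hxb : H.Adj x b) (hxc : H.Adj x c)
    (hya : H.Adj y a) (hyb : H.Adj y b) (hyc : H.Adj y c) (hxy : ¬ H.Adj x y) (hxy' : x ≠ y) :
    False := by
  obtain ⟨f, -⟩ := exists_embedding_of_fin (H := H) (B := K5MinusEdge) ![x, y, a, b, c]
    (by simp [Fin.forall_fin_succ, hab.ne, hac.ne, hbc.ne, hxa.ne, hxb.ne, hxc.ne, hya.ne, hyb.ne,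
      hyc.ne, hxy'])
    (by simp [Fin.forall_fin_succ, K5MinusEdge, hab, hac, hbc, hxa, hxb, hxc, hya, hyb,
      hyc, hxy])
  exact F ⟨_, K5MinusEdge⟩ (by simp [forbiddenFamily]) ⟨f⟩

theorem exists_embedding_K4MinusEdge {a b c c' : W} (hab : H.Adj a b)
    (hac : H.Adj a c) (hbc : H.Adj b c) (hac' : H.Adj a c') (hbc' : H.Adj b c')
    (hcc : ¬ H.Adj c c') (hcc' : c ≠ c') : ∃ f : K4MinusEdge ↪g H, ⇑f = ![c, c', a, b] :=
  exists_embedding_of_fin _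
    (by simp [Fin.forall_fin_succ, hab.ne, hac.ne', hbc.ne', hac'.ne', hbc'.ne', hcc'])
    (by simp [Fin.forall_fin_succ, K4MinusEdge, hab, hac.symm, hbc.symm, hac'.symm, hbc'.symm, hcc])

theorem exists_embedding_K3 {a b c : W} (hab : H.Adj a b) (hac : H.Adj a c) (hbc : H.Adj b c) :
    ∃ f : K 3 ↪g H, ⇑f = ![a, b, c] :=
  exists_embedding_of_fin _ (by simp [Fin.forall_fin_succ, hab.ne, hac.ne, hbc.ne])
    (by simp [Fin.forall_fin_succ, hab, hac, hbc])

theorem exists_embedding_K2 {a b : W} (hab : H.Adj a b) : ∃ f : K 2 ↪g H, ⇑f = ![a, b] :=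
  exists_embedding_of_fin _ (by simp [Fin.forall_fin_succ, hab.ne])
    (by simp [Fin.forall_fin_succ, hab])

theorem exists_embedding_pathGraph_four {x a b y : W} (hxa : H.Adj x a) (hab : H.Adj a b)
    (hby : H.Adj b y) (hxb : ¬ H.Adj x b) (hay : ¬ H.Adj a y) (hxy : ¬ H.Adj x y) :
    ∃ f : pathGraph 4 ↪g H, ⇑f = ![x, a, b, y] := by
  have hxb' : x ≠ b := by rintro rfl; exact hxy hby
  have hay' : a ≠ y := by rintro rfl; exact hxy hxa
  have hxy' : x ≠ y := by rintro rfl; exact hxb hby.symm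
  exact exists_embedding_of_fin _
    (by simp [Fin.forall_fin_succ, hxa.ne, hab.ne, hby.ne, hxb', hay', hxy'])
    (by simp [Fin.forall_fin_succ, pathGraph_adj, hxa, hab, hby, hxb, hay, hxy])

/-- If no vertex of the edgeless set `M` is adjacent to the induced copy of `B`, then `M` is
small. -/
theorem card_le_of_not_sum {V : Type*} {B : SimpleGraph V} {n : ℕ}
    (F : ¬ (B ⊕g Kbar (n + 1)).IsIndContained H) (f : B ↪g H) (M : Finset W)
    (hindep : ∀ u ∈ M, ∀ v ∈ M, ¬ H.Adj u v) (hne : ∀ u, f u ∉ M)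
    (hadj : ∀ u, ∀ m ∈ M, ¬ H.Adj (f u) m) : M.card ≤ n := by
  by_contra h
  obtain ⟨g, hg, hgM⟩ := exists_injective_fin M (by omega : n + 1 ≤ M.card)
  exact F (sum_Kbar_isIndContained f g hg (fun i j => hindep _ (hgM i) _ (hgM j))
    (fun u i h => hne u (h ▸ hgM i)) fun u i => hadj u _ (hgM i))

theorem Forb.card_le_of_K (F : Forb (forbiddenFamily d) H) {n : ℕ} (hn : n = 0 ∨ (4 ≤ n ∧ n ≤ d))
    (f : K n ↪g H) (M : Finset W) (hindep : ∀ u ∈ M, ∀ v ∈ M, ¬ H.Adj u v) (hne : ∀ u, f u ∉ M)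
    (hadj : ∀ u, ∀ m ∈ M, ¬ H.Adj (f u) m) : M.card ≤ (d - n).choose 2 :=
  card_le_of_not_sum (F ⟨_, K n ⊕g Kbar ((d - n).choose 2 + 1)⟩ (Or.inr ⟨n, hn, rfl⟩)) f M
    hindep hne hadj

theorem Forb.card_le_of_K2 (F : Forb (forbiddenFamily d) H) (f : K 2 ↪g H) (M : Finset W)
    (hindep : ∀ u ∈ M, ∀ v ∈ M, ¬ H.Adj u v) (hne : ∀ u, f u ∉ M)
    (hadj : ∀ u, ∀ m ∈ M, ¬ H.Adj (f u) m) : M.card ≤ (d - 1).choose 2 :=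
  card_le_of_not_sum (F ⟨_, K 2 ⊕g Kbar ((d - 1).choose 2 + 1)⟩
    (Or.inl (Or.inl (Or.inr (Or.inl rfl))))) f M hindep hne hadj

theorem Forb.card_le_of_K3 (F : Forb (forbiddenFamily d) H) (f : K 3 ↪g H) (M : Finset W)
    (hindep : ∀ u ∈ M, ∀ v ∈ M, ¬ H.Adj u v) (hne : ∀ u, f u ∉ M)
    (hadj : ∀ u, ∀ m ∈ M, ¬ H.Adj (f u) m) : M.card ≤ (d - 2).choose 2 :=
  card_le_of_not_sum (F ⟨_, K 3 ⊕g Kbar ((d - 2).choose 2 + 1)⟩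
    (Or.inl (Or.inl (Or.inr (Or.inr (Or.inl rfl)))))) f M hindep hne hadj

theorem Forb.card_le_of_pathGraph_four (F : Forb (forbiddenFamily d) H) (f : pathGraph 4 ↪g H)
    (M : Finset W) (hindep : ∀ u ∈ M, ∀ v ∈ M, ¬ H.Adj u v) (hne : ∀ u, f u ∉ M)
    (hadj : ∀ u, ∀ m ∈ M, ¬ H.Adj (f u) m) : M.card ≤ (d - 2).choose 2 :=
  card_le_of_not_sum (F ⟨_, pathGraph 4 ⊕g Kbar ((d - 2).choose 2 + 1)⟩
    (Or.inl (Or.inl (Or.inr (Or.inr (Or.inr rfl)))))) f M hindep hne hadj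

theorem Forb.card_le_of_K3Pend11 (F : Forb (forbiddenFamily d) H) (f : K3Pend11 1 ↪g H)
    (M : Finset W) (hindep : ∀ u ∈ M, ∀ v ∈ M, ¬ H.Adj u v) (hne : ∀ u, f u ∉ M)
    (hadj : ∀ u, ∀ m ∈ M, ¬ H.Adj (f u) m) : M.card ≤ (d - 3).choose 2 :=
  card_le_of_not_sum (F ⟨_, K3Pend11 1 ⊕g Kbar ((d - 3).choose 2 + 1)⟩
    (Or.inl (Or.inr (Or.inr (Or.inl rfl))))) f M hindep hne hadj

theorem Forb.card_le_of_K4MinusEdge (F : Forb (forbiddenFamily d) H) (f : K4MinusEdge ↪g H)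
    (M : Finset W) (hindep : ∀ u ∈ M, ∀ v ∈ M, ¬ H.Adj u v) (hne : ∀ u, f u ∉ M)
    (hadj : ∀ u, ∀ m ∈ M, ¬ H.Adj (f u) m) : M.card ≤ (d - 3).choose 2 :=
  card_le_of_not_sum (F ⟨_, K4MinusEdge ⊕g Kbar ((d - 3).choose 2 + 1)⟩
    (Or.inl (Or.inr (Or.inr (Or.inr rfl))))) f M hindep hne hadj

/-- One of `d` leaves serves as the second vertex of `K_2` in `K_2^{+(d-1)}`. -/
theorem Forb.card_le_of_star (F : Forb (forbiddenFamily d) H) (hd : 3 ≤ d) (a : W) (M : Finset W)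
    (hindep : ∀ u ∈ M, ∀ v ∈ M, ¬ H.Adj u v) (hadj : ∀ m ∈ M, H.Adj a m) : M.card ≤ d - 1 := by
  classical
  by_contra h
  obtain ⟨b, hb⟩ := Finset.card_pos.1 (by omega : 0 < M.card)
  obtain ⟨f, hf⟩ := exists_embedding_K2 (hadj b hb)
  obtain ⟨g, hg, hgM⟩ := exists_injective_fin (n := d + 1 - 2) (M.erase b) (by
    rw [Finset.card_erase_of_mem hb]
    omega)
  have hgM' : ∀ i, g i ∈ M := fun i => Finset.mem_of_mem_erase (hgM i)
  refine F ⟨_, KPend 2 (d + 1 - 2)⟩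
    (Or.inl (Or.inl (Or.inl (Or.inr ⟨2, Or.inl rfl, rfl⟩))))
    (attach_isIndContained f g hg (fun i j => hindep _ (hgM' i) _ (hgM' j)) ?_ ?_)
  · simp only [hf, Fin.forall_fin_two]
    exact ⟨fun i => (hadj _ (hgM' i)).ne, fun i => (Finset.ne_of_mem_erase (hgM i)).symm⟩
  · simp only [hf, Fin.forall_fin_two]
    exact ⟨fun i => by simpa using hadj _ (hgM' i), fun i => by simpa using hindep _ hb _ (hgM' i)⟩

theorem Forb.card_le_of_KPend (F : Forb (forbiddenFamily d) H) (C : Finset W)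
    (hC : ∀ u ∈ C, ∀ v ∈ C, u ≠ v → H.Adj u v) (hC4 : 4 ≤ C.card) (hCd : C.card ≤ d) {a : W}
    (ha : a ∈ C) (M : Finset W) (hindep : ∀ u ∈ M, ∀ v ∈ M, ¬ H.Adj u v) (hM : ∀ m ∈ M, m ∉ C)
    (hadj : ∀ m ∈ M, ∀ c ∈ C, H.Adj m c ↔ c = a) : M.card ≤ d - C.card := by
  by_contra h
  obtain ⟨f, hf, hfa⟩ := exists_embedding_K C hC rfl (by omega) ha
  obtain ⟨g, hg, hgM⟩ := exists_injective_fin (n := d + 1 - C.card) M (by omega)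
  refine F ⟨_, KPend C.card (d + 1 - C.card)⟩
    (Or.inl (Or.inl (Or.inl (Or.inr ⟨C.card, Or.inr ⟨hC4, by omega⟩, rfl⟩))))
    (attach_isIndContained f g hg (fun i j => hindep _ (hgM i) _ (hgM j)) ?_ ?_)
  · intro u i h
    exact hM _ (hgM i) (h ▸ hf u)
  · intro u i
    rw [H.adj_comm, hadj _ (hgM i) _ (hf u), ← hfa, f.injective.eq_iff, Fin.ext_iff]
    rfl

/-- The member of the family with `i = d + 1` has no pendant vertices, so it is `K_{d+1}`. -/
theorem Forb.clique_card_le (F : Forb (forbiddenFamily d) H) (hd : 3 ≤ d) (C : Finset W)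
    (hC : ∀ u ∈ C, ∀ v ∈ C, u ≠ v → H.Adj u v) : C.card ≤ d := by
  by_contra h
  obtain ⟨D, hDC, hD⟩ := Finset.exists_subset_card_eq (by omega : d + 1 ≤ C.card)
  obtain ⟨a, ha⟩ := Finset.card_pos.1 (by omega : 0 < D.card)
  obtain ⟨f, -, -⟩ := exists_embedding_K D
    (fun u hu v hv => hC u (hDC hu) v (hDC hv)) hD (by omega) ha
  have : IsEmpty (Fin (d + 1 - (d + 1))) := by
    rw [Nat.sub_self]
    infer_instance
  exact F ⟨_, KPend (d + 1) (d + 1 - (d + 1))⟩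
    (Or.inl (Or.inl (Or.inl (Or.inr ⟨d + 1, Or.inr ⟨by omega, le_rfl⟩, rfl⟩))))
    (attach_isIndContained f isEmptyElim (fun i => isEmptyElim i) (fun i => isEmptyElim i)
      (fun _ i => isEmptyElim i) fun _ i => isEmptyElim i)

theorem Forb.card_le_of_K4MinusEdgePend (F : Forb (forbiddenFamily d) H) (hd : 3 ≤ d)
    {a b c c' : W} (hab : H.Adj a b) (hac : H.Adj a c) (hbc : H.Adj b c) (hac' : H.Adj a c')
    (hbc' : H.Adj b c') (hcc : ¬ H.Adj c c') (hcc' : c ≠ c') (M : Finset W)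
    (hindep : ∀ u ∈ M, ∀ v ∈ M, ¬ H.Adj u v) (ha : ∀ m ∈ M, H.Adj a m)
    (hb : ∀ m ∈ M, ¬ H.Adj b m) (hc : ∀ m ∈ M, ¬ H.Adj c m) (hc' : ∀ m ∈ M, ¬ H.Adj c' m) :
    M.card ≤ d - 3 := by
  by_contra h
  obtain ⟨f, hf⟩ := exists_embedding_K4MinusEdge hab hac hbc hac' hbc' hcc hcc'
  obtain ⟨g, hg, hgM⟩ := exists_injective_fin (n := d - 2) M (by omega)
  refine F ⟨_, K4MinusEdgePend (d - 2)⟩ (by simp [forbiddenFamily])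
    (attach_isIndContained f g hg (fun i j => hindep _ (hgM i) _ (hgM j)) ?_ ?_)
  · intro u i h
    -- Members of `M` are nonadjacent to `b`, which excludes `a`, `c` and `c'`, and nonadjacent to
    -- `c`, which excludes `b`.
    have hbu : H.Adj b (f u) → False := fun h' => hb _ (hgM i) (h ▸ h')
    have hau : f u ≠ b := fun h' => hc _ (hgM i) (h ▸ h' ▸ hbc.symm)
    revert hbu hau
    fin_cases u <;> simp [hf, hbc, hbc', hab.symm]
  · intro u i
    have ha := ha _ (hgM i)
    have hb := hb _ (hgM i)
    have hc := hc _ (hgM i)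
    have hc' := hc' _ (hgM i)
    fin_cases u <;> simp [hf, ha, hb, hc, hc']

theorem Forb.card_le_of_K3Pend1 (F : Forb (forbiddenFamily d) H) (hd : 3 ≤ d)
    {a b c c' : W} (hab : H.Adj a b) (hac : H.Adj a c) (hbc : H.Adj b c) (hbc' : H.Adj b c')
    (hcc' : H.Adj c c') (hac' : ¬ H.Adj a c') (hne : a ≠ c') (M : Finset W)
    (hindep : ∀ u ∈ M, ∀ v ∈ M, ¬ H.Adj u v) (ha : ∀ m ∈ M, H.Adj a m)
    (hb : ∀ m ∈ M, ¬ H.Adj b m) (hc : ∀ m ∈ M, ¬ H.Adj c m) (hc' : ∀ m ∈ M, ¬ H.Adj c' m) :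
    M.card ≤ d - 3 := by
  by_contra h
  obtain ⟨f, hf⟩ := exists_embedding_K3 hab hac hbc
  obtain ⟨g, hg, hgM⟩ := exists_injective_fin (n := d - 2) M (by omega)
  refine F ⟨_, K3Pend1 (d - 2)⟩ (by simp [forbiddenFamily])
    (attach_isIndContained f (Sum.elim g fun _ => c')
      (hg.sumElim (Function.injective_of_subsingleton _)
        fun i _ h => hb _ (hgM i) (h ▸ hbc')) ?_ ?_ ?_)
  · rintro (i | i) (j | j)
    · exact hindep _ (hgM i) _ (hgM j)
    · exact fun h => hc' _ (hgM i) h.symm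
    · exact hc' _ (hgM j)
    · exact H.loopless.irrefl _
  · rintro u (i | i)
    · have hb' : b ≠ g i := fun h => hc _ (hgM i) (h ▸ hbc.symm)
      have hc' : c ≠ g i := fun h => hb _ (hgM i) (h ▸ hbc)
      fin_cases u <;> simp [hf, (ha _ (hgM i)).ne, hb', hc']
    · fin_cases u <;> simp [hf, hne, hbc'.ne, hcc'.ne]
  · rintro u (i | i)
    · have ha := ha _ (hgM i)
      have hb := hb _ (hgM i)
      have hc := hc _ (hgM i)
      fin_cases u <;> simp [hf, ha, hb, hc]
    · fin_cases u <;> simp [hf, hac', hbc', hcc']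

/-- With `s = d - 2` this bounds the pendant vertices at `a`; with `s = 1` and `M` a single vertex
it yields the net to which isolated vertices are added. The description of the image serves to
separate it from those. -/
theorem exists_embedding_K3Pend11 {s : ℕ}
    {a b c b' c' : W} (hab : H.Adj a b) (hac : H.Adj a c) (hbc : H.Adj b c) (hbb' : H.Adj b b')
    (hcc' : H.Adj c c') (hab' : ¬ H.Adj a b') (hcb' : ¬ H.Adj c b') (hac' : ¬ H.Adj a c')
    (hbc' : ¬ H.Adj b c') (hbc'' : ¬ H.Adj b' c') (M : Finset W) (hs : s ≤ M.card)
    (hindep : ∀ u ∈ M, ∀ v ∈ M, ¬ H.Adj u v) (ha : ∀ m ∈ M, H.Adj a m)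
    (hb : ∀ m ∈ M, ¬ H.Adj b m) (hc : ∀ m ∈ M, ¬ H.Adj c m) (hb' : ∀ m ∈ M, ¬ H.Adj b' m)
    (hc' : ∀ m ∈ M, ¬ H.Adj c' m) :
    ∃ φ : K3Pend11 s ↪g H, ∀ x, φ x ∈ M ∨ φ x = a ∨ φ x = b ∨ φ x = c ∨ φ x = b' ∨ φ x = c' := by
  obtain ⟨f, hf⟩ := exists_embedding_K3 hab hac hbc
  obtain ⟨g, hg, hgM⟩ := exists_injective_fin (n := s) M hs
  have hne' : b' ≠ c' := by rintro rfl; exact hbc' hbb'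
  have hinj : Function.Injective ![b', c'] := by
    intro i j
    fin_cases i <;> fin_cases j <;> simp [hne', hne'.symm]
  obtain ⟨φ, hφ⟩ : ∃ φ : K3Pend11 s ↪g H, ⇑φ = Sum.elim f (Sum.elim g ![b', c']) := by
    refine exists_embedding_attach f (Sum.elim g ![b', c']) (hg.sumElim hinj ?_) ?_ ?_ ?_
    · intro i j h
      fin_cases j
      · exact hb _ (hgM i) (h ▸ hbb')
      · exact hc _ (hgM i) (h ▸ hcc')
    · rintro (i | i) (j | j)
      · exact hindep _ (hgM i) _ (hgM j)
      · have hb' := hb' _ (hgM i)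
        have hc' := hc' _ (hgM i)
        rw [H.adj_comm] at hb' hc'
        fin_cases j <;> simp [hb', hc']
      · fin_cases i <;> simp [hb' _ (hgM j), hc' _ (hgM j)]
      · fin_cases i <;> fin_cases j <;> simp [hbc'', H.adj_comm c' b']
    · rintro u (i | i)
      · have hb' : b ≠ g i := fun h => hc _ (hgM i) (h ▸ hbc.symm)
        have hc' : c ≠ g i := fun h => hb _ (hgM i) (h ▸ hbc)
        fin_cases u <;> simp [hf, (ha _ (hgM i)).ne, hb', hc']
      · have h1 : a ≠ b' := by rintro rfl; exact hcb' hac.symm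
        have h2 : a ≠ c' := by rintro rfl; exact hbc' hab.symm
        have h3 : c ≠ b' := by rintro rfl; exact hab' hac
        have h4 : b ≠ c' := by rintro rfl; exact hac' hab
        fin_cases u <;> fin_cases i <;> simp [hf, h1, h2, h3, h4, hbb'.ne, hcc'.ne]
    · rintro u (i | i)
      · fin_cases u <;> simp [hf, ha _ (hgM i), hb _ (hgM i), hc _ (hgM i)]
      · fin_cases u <;> fin_cases i <;> simp [hf, hab', hcb', hac', hbc', hbb', hcc']
  refine ⟨φ, ?_⟩
  rw [hφ]
  rintro (i | i | i)
  · fin_cases i <;> simp [hf]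
  · exact Or.inl (hgM i)
  · fin_cases i <;> simp

theorem Forb.card_le_of_net_pendants (F : Forb (forbiddenFamily d) H) (hd : 3 ≤ d)
    {a b c b' c' : W} (hab : H.Adj a b) (hac : H.Adj a c) (hbc : H.Adj b c) (hbb' : H.Adj b b')
    (hcc' : H.Adj c c') (hab' : ¬ H.Adj a b') (hcb' : ¬ H.Adj c b') (hac' : ¬ H.Adj a c')
    (hbc' : ¬ H.Adj b c') (hbc'' : ¬ H.Adj b' c') (M : Finset W)
    (hindep : ∀ u ∈ M, ∀ v ∈ M, ¬ H.Adj u v) (ha : ∀ m ∈ M, H.Adj a m)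
    (hb : ∀ m ∈ M, ¬ H.Adj b m) (hc : ∀ m ∈ M, ¬ H.Adj c m) (hb' : ∀ m ∈ M, ¬ H.Adj b' m)
    (hc' : ∀ m ∈ M, ¬ H.Adj c' m) :
    M.card ≤ d - 3 := by
  by_contra h
  obtain ⟨φ, -⟩ := exists_embedding_K3Pend11 (s := d - 2) hab hac hbc hbb' hcc' hab' hcb' hac'
    hbc' hbc'' M (by omega) hindep ha hb hc hb' hc'
  exact F ⟨_, K3Pend11 (d - 2)⟩ (by simp [forbiddenFamily]) ⟨φ⟩

/-- In a diamond, one of the two nonadjacent vertices has no neighbours outside the diamond. -/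
theorem Forb.simplicial_of_diamond (F : Forb (forbiddenFamily d) H)
    (hK4 : ∀ a b c v, H.Adj a b → H.Adj a c → H.Adj b c → ¬ (H.Adj v a ∧ H.Adj v b ∧ H.Adj v c))
    {a b c c' : W} (hab : H.Adj a b) (hac : H.Adj a c) (hbc : H.Adj b c) (hac' : H.Adj a c')
    (hbc' : H.Adj b c') (hcc : ¬ H.Adj c c') (hcc' : c ≠ c') :
    (∀ y, H.Adj c y → y = a ∨ y = b) ∨ (∀ y, H.Adj c' y → y = a ∨ y = b) := by
  by_contra! h
  obtain ⟨⟨x, hcx, hxa, hxb⟩, y, hcy, hya, hyb⟩ := h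
  -- Without a `K_4`, an outside neighbour of `c` or `c'` misses `a` or `b`.
  have hp : ∀ z c, H.Adj c z → H.Adj a c → H.Adj b c → z ≠ a → z ≠ b →
      ∃ p, H.Adj p c ∧ ¬ H.Adj z p ∧ z ≠ p ∧ (p = a ∨ p = b) := by
    intro z c hcz hac hbc hza hzb
    by_cases h : H.Adj z a
    · exact ⟨b, hbc, fun h' => hK4 a b c z hab hac hbc ⟨h, h', hcz.symm⟩, hzb, Or.inr rfl⟩
    · exact ⟨a, hac, h, hza, Or.inl rfl⟩
  obtain ⟨p, hpc, hxp, hxp', hpab⟩ := hp x c hcx hac hbc hxa hxb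
  obtain ⟨q, hqc, hyq, hyq', hqab⟩ := hp y c' hcy hac' hbc' hya hyb
  have hpc' : H.Adj p c' := by rcases hpab with rfl | rfl <;> assumption
  have hqc' : H.Adj q c := by rcases hqab with rfl | rfl <;> assumption
  have hxc' : ¬ H.Adj x c' := fun h => F.no_C4 hcx h hpc'.symm hpc hcc hxp hcc' hxp'
  have hyc : ¬ H.Adj y c := fun h =>
    F.no_C4 hcy h hqc'.symm hqc (fun h => hcc h.symm) hyq hcc'.symm hyq'
  have hxy : H.Adj x y := by
    by_contra hxy
    exact F.no_two_K2 hcx hcy hcc (fun h => hyc h.symm) hxc' hxy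
  -- The closed walk `x, c, p, c', y` is an induced `C_5` unless the chord `yp` is present, and then
  -- `x, y, p, c` is an induced `C_4`.
  by_cases hyp : H.Adj y p
  · exact F.no_C4 hxy hyp hpc hcx hxp hyc hxp' (by rintro rfl; exact hcc hcy.symm)
  · exact F.no_C5 hcx.symm hpc.symm hpc' hcy hxy.symm hxp hxc' hcc (fun h => hyc h.symm)
      (fun h => hyp h.symm)

end Forbidden

/-! ### Graphs without forbidden induced subgraphs have pair models -/

section Sufficiency

variable {W : Type*} [Fintype W] {H : SimpleGraph W} {d : ℕ}

theorem exists_isPairModel_of_triangle (hd : 3 ≤ d) {a b c : W} (hab : H.Adj a b)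
    (hac : H.Adj a c) (hbc : H.Adj b c) (hK4 : ∀ v, ¬ (H.Adj v a ∧ H.Adj v b ∧ H.Adj v c))
    (hindep : ∀ u, u ≠ a ∧ u ≠ b ∧ u ≠ c → ∀ v, v ≠ a ∧ v ≠ b ∧ v ≠ c → ¬ H.Adj u v)
    (h2 : ∀ u v, u ≠ a ∧ u ≠ b ∧ u ≠ c → v ≠ a ∧ v ≠ b ∧ v ≠ c → u ≠ v →
      ¬ (H.Adj u a ∧ H.Adj u b ∧ H.Adj v a ∧ H.Adj v b) ∧
      ¬ (H.Adj u a ∧ H.Adj u c ∧ H.Adj v a ∧ H.Adj v c) ∧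
      ¬ (H.Adj u b ∧ H.Adj u c ∧ H.Adj v b ∧ H.Adj v c))
    (h1a : ∀ M : Finset W, (∀ v ∈ M, v ≠ a ∧ v ≠ b ∧ v ≠ c) → (∀ v ∈ M, H.Adj a v) →
      (∀ v ∈ M, ¬ H.Adj b v) → (∀ v ∈ M, ¬ H.Adj c v) → M.card ≤ d - 3)
    (h1b : ∀ M : Finset W, (∀ v ∈ M, v ≠ a ∧ v ≠ b ∧ v ≠ c) → (∀ v ∈ M, H.Adj b v) →
      (∀ v ∈ M, ¬ H.Adj a v) → (∀ v ∈ M, ¬ H.Adj c v) → M.card ≤ d - 3)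
    (h1c : ∀ M : Finset W, (∀ v ∈ M, v ≠ a ∧ v ≠ b ∧ v ≠ c) → (∀ v ∈ M, H.Adj c v) →
      (∀ v ∈ M, ¬ H.Adj a v) → (∀ v ∈ M, ¬ H.Adj b v) → M.card ≤ d - 3)
    (h0 : ∀ M : Finset W, (∀ v ∈ M, v ≠ a ∧ v ≠ b ∧ v ≠ c) → (∀ v ∈ M, ¬ H.Adj a v) →
      (∀ v ∈ M, ¬ H.Adj b v) → (∀ v ∈ M, ¬ H.Adj c v) → M.card ≤ (d - 3).choose 2) :
    ∃ A : W → Finset (Fin d), Function.Injective A ∧ IsPairModel H A := by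
  classical
  have hcard : ({a, b, c} : Finset W).card = 3 :=
    Finset.card_eq_three.2 ⟨a, b, c, hab.ne, hac.ne, hbc.ne, rfl⟩
  have hmem : ∀ v, v ∉ ({a, b, c} : Finset W) ↔ v ≠ a ∧ v ≠ b ∧ v ≠ c := by simp
  refine exists_isPairModel_of_split hd {a, b, c} (hcard.trans_le hd) ?_ ?_ ?_ ?_ ?_ ?_
  · simp [hab, hac, hbc, hab.symm, hac.symm, hbc.symm]
  · simpa only [hmem] using hindep
  · intro v _ S hS hSv
    by_contra hlt
    have : S = {a, b, c} := Finset.eq_of_subset_of_card_le hS (by omega)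
    subst this
    exact hK4 v (by simpa using hSv)
  · intro u v hu hv huv x hx y hy hxy hux huy hvx hvy
    obtain ⟨h, h', h''⟩ := h2 u v ((hmem u).1 hu) ((hmem v).1 hv) huv
    simp only [Finset.mem_insert, Finset.mem_singleton] at hx hy
    rcases hx with rfl | rfl | rfl <;> rcases hy with rfl | rfl | rfl <;> tauto
  · rw [hcard]
    intro x hx M hM hMx
    have hMabc := fun v hv => (hmem v).1 (hM v hv)
    have hMa := fun v hv => hMx v hv a (by simp)
    have hMb := fun v hv => hMx v hv b (by simp)
    have hMc := fun v hv => hMx v hv c (by simp)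
    simp only [H.adj_comm _ a, H.adj_comm _ b, H.adj_comm _ c] at hMa hMb hMc
    simp only [Finset.mem_insert, Finset.mem_singleton] at hx
    rcases hx with rfl | rfl | rfl
    · exact h1a M hMabc (fun v hv => (hMa v hv).2 rfl) (fun v hv h => hab.ne' ((hMb v hv).1 h))
        (fun v hv h => hac.ne' ((hMc v hv).1 h))
    · exact h1b M hMabc (fun v hv => (hMb v hv).2 rfl) (fun v hv h => hab.ne ((hMa v hv).1 h))
        (fun v hv h => hbc.ne' ((hMc v hv).1 h))
    · exact h1c M hMabc (fun v hv => (hMc v hv).2 rfl) (fun v hv h => hac.ne ((hMa v hv).1 h))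
        (fun v hv h => hbc.ne ((hMb v hv).1 h))
  · rw [hcard]
    intro M hM hMx
    exact h0 M (fun v hv => (hmem v).1 (hM v hv)) (fun v hv h => hMx v hv a (by simp) h.symm)
      (fun v hv h => hMx v hv b (by simp) h.symm) (fun v hv h => hMx v hv c (by simp) h.symm)

theorem Forb.exists_isPairModel_of_edge (F : Forb (forbiddenFamily d) H) (hd : 3 ≤ d) {a b : W}
    (hab : H.Adj a b)
    (hindep : ∀ u, u ≠ a ∧ u ≠ b → ∀ v, v ≠ a ∧ v ≠ b → ¬ H.Adj u v)
    (h2 : ∀ u v, u ≠ v → H.Adj u a → H.Adj u b → H.Adj v a → H.Adj v b → False)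
    (h0 : ∀ M : Finset W, (∀ v ∈ M, v ≠ a ∧ v ≠ b) → (∀ v ∈ M, ¬ H.Adj a v) →
      (∀ v ∈ M, ¬ H.Adj b v) → M.card ≤ (d - 2).choose 2) :
    ∃ A : W → Finset (Fin d), Function.Injective A ∧ IsPairModel H A := by
  classical
  have hcard : ({a, b} : Finset W).card = 2 := Finset.card_pair hab.ne
  have hmem : ∀ v, v ∉ ({a, b} : Finset W) ↔ v ≠ a ∧ v ≠ b := by simp
  -- The other end `y` of the edge is one more leaf at `x`, which improves the star bound `d - 1` to
  -- `d - 2`.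
  have hstar : ∀ x y, H.Adj x y → (y = a ∨ y = b) → ∀ M : Finset W, (∀ v ∈ M, v ≠ a ∧ v ≠ b) →
      (∀ v ∈ M, H.Adj x v) → (∀ v ∈ M, ¬ H.Adj y v) → M.card ≤ d - 2 := by
    intro x y hxy hyab M hM hx hy
    have hyM : y ∉ M := fun h => hyab.elim (hM y h).1 (hM y h).2
    have := F.card_le_of_star hd x (insert y M) (by
      intro u hu v hv
      rw [Finset.mem_insert] at hu hv
      rcases hu with rfl | hu <;> rcases hv with rfl | hv
      · exact H.loopless.irrefl _
      · exact hy v hv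
      · exact fun h => hy u hu h.symm
      · exact hindep u (hM u hu) v (hM v hv))
      (by simpa [hxy] using hx)
    rw [Finset.card_insert_of_notMem hyM] at this
    omega
  refine exists_isPairModel_of_split hd {a, b} (by omega) ?_ ?_ ?_ ?_ ?_ ?_
  · simp [hab, hab.symm]
  · simpa only [hmem] using hindep
  · intro v _ S hS _
    exact (Finset.card_le_card hS).trans hcard.le
  · intro u v hu hv huv x hx y hy hxy hux huy hvx hvy
    simp only [Finset.mem_insert, Finset.mem_singleton] at hx hy
    have := h2 u v huv
    rcases hx with rfl | rfl <;> rcases hy with rfl | rfl <;> tauto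
  · rw [hcard]
    intro x hx M hM hMx
    have hMab := fun v hv => (hmem v).1 (hM v hv)
    have hMa := fun v hv => hMx v hv a (by simp)
    have hMb := fun v hv => hMx v hv b (by simp)
    simp only [H.adj_comm _ a, H.adj_comm _ b] at hMa hMb
    simp only [Finset.mem_insert, Finset.mem_singleton] at hx
    rcases hx with rfl | rfl
    · exact hstar _ _ hab (Or.inr rfl) M hMab (fun v hv => (hMa v hv).2 rfl)
        (fun v hv h => hab.ne' ((hMb v hv).1 h))
    · exact hstar _ _ hab.symm (Or.inl rfl) M hMab (fun v hv => (hMb v hv).2 rfl)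
        (fun v hv h => hab.ne ((hMa v hv).1 h))
  · rw [hcard]
    intro M hM hMx
    exact h0 M (fun v hv => (hmem v).1 (hM v hv)) (fun v hv h => hMx v hv a (by simp) h.symm)
      (fun v hv h => hMx v hv b (by simp) h.symm)

/-- A vertex outside `C` misses some vertex of `C`, so three neighbours in `C` would give `K_5 - e`.
The other hypotheses of `exists_isPairModel_of_split` follow similarly from the spare vertices of
`C`. -/
theorem Forb.exists_isPairModel_of_large_clique (F : Forb (forbiddenFamily d) H) (hd : 3 ≤ d)
    (C : Finset W) (hC : ∀ u ∈ C, ∀ v ∈ C, u ≠ v → H.Adj u v) (hC4 : 4 ≤ C.card)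
    (hmax : ∀ v, v ∉ C → ∃ w ∈ C, ¬ H.Adj v w) :
    ∃ A : W → Finset (Fin d), Function.Injective A ∧ IsPairModel H A := by
  classical
  have hCd := F.clique_card_le hd C hC
  have h3 : ∀ v, v ∉ C → ∀ S ⊆ C, (∀ s ∈ S, H.Adj v s) → S.card ≤ 2 := by
    intro v hv S hS hSv
    by_contra! hlt
    obtain ⟨a, ha, b, hb, c, hc, hab, hac, hbc⟩ := Finset.two_lt_card.1 hlt
    obtain ⟨w, hw, hvw⟩ := hmax v hv
    have hne : ∀ s ∈ S, w ≠ s := fun s hs h => hvw (h ▸ hSv s hs)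
    exact F.no_K5MinusEdge (hC a (hS ha) b (hS hb) hab) (hC a (hS ha) c (hS hc) hac)
      (hC b (hS hb) c (hS hc) hbc) (hSv a ha) (hSv b hb) (hSv c hc)
      (hC w hw a (hS ha) (hne a ha)) (hC w hw b (hS hb) (hne b hb))
      (hC w hw c (hS hc) (hne c hc)) hvw (fun h => hv (h ▸ hw))
  have hindep : ∀ u, u ∉ C → ∀ v, v ∉ C → ¬ H.Adj u v := by
    intro u hu v hv huv
    have hfil : ∀ w, w ∉ C → (C.filter (H.Adj w)).card ≤ 2 := fun w hw =>
      h3 w hw _ (Finset.filter_subset _ _) fun s hs => (Finset.mem_filter.1 hs).2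
    -- Incomparable neighbourhoods give an induced `C_4`. Nested ones together cover at most two
    -- vertices of `C`, and two uncovered ones form a `2K_2` with `uv`.
    have hnest : C.filter (H.Adj u) ⊆ C.filter (H.Adj v) ∨
        C.filter (H.Adj v) ⊆ C.filter (H.Adj u) := by
      by_contra! h
      obtain ⟨x, hx, hx'⟩ := Finset.not_subset.1 h.1
      obtain ⟨y, hy, hy'⟩ := Finset.not_subset.1 h.2
      rw [Finset.mem_filter] at hx hy
      have hvx : ¬ H.Adj v x := fun h => hx' (Finset.mem_filter.2 ⟨hx.1, h⟩)
      have huy : ¬ H.Adj u y := fun h => hy' (Finset.mem_filter.2 ⟨hy.1, h⟩)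
      have hxy : x ≠ y := fun h => huy (h ▸ hx.2)
      exact F.no_C4 hx.2 (hC x hx.1 y hy.1 hxy) hy.2.symm huv.symm huy
        (fun h => hvx h.symm) (fun h => hu (h ▸ hy.1)) (fun h => hv (h ▸ hx.1))
    have hun : (C.filter (H.Adj u) ∪ C.filter (H.Adj v)).card ≤ 2 := by
      rcases hnest with h | h
      · rw [Finset.union_eq_right.2 h]
        exact hfil v hv
      · rw [Finset.union_eq_left.2 h]
        exact hfil u hu
    have hlt : 1 < (C \ (C.filter (H.Adj u) ∪ C.filter (H.Adj v))).card := by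
      have := Finset.le_card_sdiff (C.filter (H.Adj u) ∪ C.filter (H.Adj v)) C
      omega
    obtain ⟨x, hx, y, hy, hxy⟩ := Finset.one_lt_card.1 hlt
    simp only [Finset.mem_sdiff, Finset.mem_union, Finset.mem_filter, not_or, not_and] at hx hy
    exact F.no_two_K2 huv (hC x hx.1 y hy.1 hxy) (hx.2.1 hx.1) (hy.2.1 hy.1) (hx.2.2 hx.1)
      (hy.2.2 hy.1)
  refine exists_isPairModel_of_split hd C hCd hC hindep h3 ?_ ?_ ?_
  · intro u v hu hv huv a ha b hb hab hua hub hva hvb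
    have hthird : ∀ w, w ∉ C → H.Adj w a → H.Adj w b → ∀ c ∈ C, c ≠ a → c ≠ b → ¬ H.Adj w c := by
      intro w hw hwa hwb c hc hca hcb hwc
      have := h3 w hw {a, b, c} (by simp [Finset.insert_subset_iff, ha, hb, hc])
        (by simp [hwa, hwb, hwc])
      rw [Finset.card_eq_three.2 ⟨a, b, c, hab, hca.symm, hcb.symm, rfl⟩] at this
      omega
    -- A further vertex of `C` is the third vertex, besides `u` and `v`, attached to `ab` in
    -- `K_{2,3} + e`.
    have hlt : 0 < (C \ {a, b}).card := by
      have := Finset.le_card_sdiff {a, b} C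
      have := Finset.card_le_two (a := a) (b := b)
      omega
    obtain ⟨c, hc⟩ := Finset.card_pos.1 hlt
    simp only [Finset.mem_sdiff, Finset.mem_insert, Finset.mem_singleton, not_or] at hc
    obtain ⟨hc, hca, hcb⟩ := hc
    exact F.no_K23PlusEdge (hC a ha b hb hab) hua.symm hva.symm (hC a ha c hc (Ne.symm hca)) hub.symm
      hvb.symm (hC b hb c hc (Ne.symm hcb)) (hindep u hu v hv) (hthird u hu hua hub c hc hca hcb)
      (hthird v hv hva hvb c hc hca hcb) huv (fun h => hu (h ▸ hc)) (fun h => hv (h ▸ hc))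
  · intro a ha M hM hMa
    exact F.card_le_of_KPend C hC hC4 hCd ha M
      (fun u hu v hv => hindep u (hM u hu) v (hM v hv)) hM hMa
  · intro M hM hMC
    obtain ⟨a, ha⟩ := Finset.card_pos.1 (by omega : 0 < C.card)
    obtain ⟨f, hf, -⟩ := exists_embedding_K C hC rfl (by omega) ha
    exact F.card_le_of_K (Or.inr ⟨hC4, hCd⟩) f M
      (fun u hu v hv => hindep u (hM u hu) v (hM v hv)) (fun i h => hM _ h (hf i))
      fun i m hm h => hMC m hm _ (hf i) h.symm

/-- The clique is `{a, b, c}`, and `c'` becomes the pair belonging to `a` and `b`. Keeping `c'` in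
the forbidden graphs sharpens the bounds to those for three singletons. -/
theorem Forb.exists_isPairModel_of_diamond (F : Forb (forbiddenFamily d) H) (hd : 3 ≤ d)
    (hK4 : ∀ a b c v, H.Adj a b → H.Adj a c → H.Adj b c → ¬ (H.Adj v a ∧ H.Adj v b ∧ H.Adj v c))
    {a b c c' : W} (hab : H.Adj a b) (hac : H.Adj a c) (hbc : H.Adj b c) (hac' : H.Adj a c')
    (hbc' : H.Adj b c') (hcc : ¬ H.Adj c c') (hcc' : c ≠ c')
    (honly : ∀ y, H.Adj c' y → y = a ∨ y = b) :
    ∃ A : W → Finset (Fin d), Function.Injective A ∧ IsPairModel H A := by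
  have hc' : ∀ v, v ≠ a ∧ v ≠ b ∧ v ≠ c → ¬ H.Adj c' v := fun v hv h =>
    (honly v h).elim hv.1 hv.2.1
  have key : ∀ v, v ≠ a ∧ v ≠ b ∧ v ≠ c → H.Adj v a → H.Adj v b → v = c' := by
    intro v hv hva hvb
    by_contra hne
    exact F.no_K23PlusEdge hab hac hac' hva.symm hbc hbc' hvb.symm hcc
      (fun h => hK4 a b c v hab hac hbc ⟨hva, hvb, h.symm⟩) (hc' v hv) hcc' hv.2.2.symm
      (Ne.symm hne)
  have hindep : ∀ u, u ≠ a ∧ u ≠ b ∧ u ≠ c → ∀ v, v ≠ a ∧ v ≠ b ∧ v ≠ c → ¬ H.Adj u v := by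
    intro u hu v hv huv
    have huc : ¬ H.Adj u c' := fun h => hc' u hu h.symm
    have hvc : ¬ H.Adj v c' := fun h => hc' v hv h.symm
    have hu' : u ≠ c' := by rintro rfl; exact hc' v hv huv
    have hv' : v ≠ c' := by rintro rfl; exact hc' u hu huv.symm
    -- An edge `uv` must meet the neighbourhood of `a` and that of `b`, by comparison with `ac'` and
    -- `bc'`. By `key` neither end sees both, so `u, v, a, b` span a `C_4`.
    have h1 : H.Adj u a ∨ H.Adj v a := by
      by_contra! h
      exact F.no_two_K2 huv hac' h.1 huc h.2 hvc
    have h2 : H.Adj u b ∨ H.Adj v b := by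
      by_contra! h
      exact F.no_two_K2 huv hbc' h.1 huc h.2 hvc
    have hC4 : ∀ u v, u ≠ a ∧ u ≠ b ∧ u ≠ c → v ≠ a ∧ v ≠ b ∧ v ≠ c → u ≠ c' → v ≠ c' →
        H.Adj u v → H.Adj u a → H.Adj v b → False := by
      intro u v hu hv hu' hv' huv hua hvb
      exact F.no_C4 hua hab hvb.symm huv.symm (fun h => hu' (key u hu hua h))
        (fun h => hv' (key v hv h.symm hvb)) hu.2.1 hv.1.symm
    rcases h1 with h1 | h1 <;> rcases h2 with h2 | h2
    · exact hu' (key u hu h1 h2)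
    · exact hC4 u v hu hv hu' hv' huv h1 h2
    · exact hC4 v u hv hu hv' hu' huv.symm h1 h2
    · exact hv' (key v hv h1 h2)
  have hMindep : ∀ M : Finset W, (∀ v ∈ M, v ≠ a ∧ v ≠ b ∧ v ≠ c) →
      ∀ u ∈ M, ∀ v ∈ M, ¬ H.Adj u v := fun M hM u hu v hv => hindep u (hM u hu) v (hM v hv)
  refine exists_isPairModel_of_triangle hd hab hac hbc (fun v => hK4 a b c v hab hac hbc) hindep
    ?_ ?_ ?_ ?_ ?_
  · refine fun u v hu hv huv => ⟨?_, ?_, ?_⟩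
    · rintro ⟨hua, hub, hva, hvb⟩
      exact huv ((key u hu hua hub).trans (key v hv hva hvb).symm)
    · rintro ⟨hua, huc, hva, hvc⟩
      exact F.no_K23PlusEdge hac hua.symm hva.symm hab huc.symm hvc.symm hbc.symm
        (hindep u hu v hv) (fun h => hK4 a b c u hab hac hbc ⟨hua, h, huc⟩)
        (fun h => hK4 a b c v hab hac hbc ⟨hva, h, hvc⟩) huv hu.2.1 hv.2.1
    · rintro ⟨hub, huc, hvb, hvc⟩
      exact F.no_K23PlusEdge hbc hub.symm hvb.symm hab.symm huc.symm hvc.symm hac.symm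
        (hindep u hu v hv) (fun h => hK4 a b c u hab hac hbc ⟨h, hub, huc⟩)
        (fun h => hK4 a b c v hab hac hbc ⟨h, hvb, hvc⟩) huv hu.1 hv.1
  · intro M hM ha hb hc
    exact F.card_le_of_K4MinusEdgePend hd hab hac hbc hac' hbc' hcc hcc' M (hMindep M hM) ha hb hc
      fun v hv => hc' v (hM v hv)
  · intro M hM hb ha hc
    exact F.card_le_of_K4MinusEdgePend hd hab.symm hbc hac hbc' hac' hcc hcc' M (hMindep M hM) hb ha
      hc fun v hv => hc' v (hM v hv)
  · intro M hM hc ha hb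
    exact F.card_le_of_K3Pend1 hd hac.symm hbc.symm hab hac' hbc' hcc hcc' M (hMindep M hM) hc ha
      hb fun v hv => hc' v (hM v hv)
  · intro M hM ha hb hc
    obtain ⟨f, hf⟩ := exists_embedding_K4MinusEdge hab hac hbc hac' hbc' hcc hcc'
    refine F.card_le_of_K4MinusEdge f M (hMindep M hM) ?_ ?_
    · simp only [hf, Fin.forall_fin_succ]
      simpa using ⟨fun h => (hM c h).2.2 rfl, fun h => ha c' h hac', fun h => (hM a h).1 rfl,
        fun h => (hM b h).2.1 rfl⟩
    · simp only [hf, Fin.forall_fin_succ]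
      simpa using ⟨hc, fun v hv => hc' v (hM v hv), ha, hb⟩

/-- Any two outside neighbours at two triangle vertices certify the pendant bound at the third; all
three certify the bound on vertices without neighbours in the triangle. -/
theorem Forb.exists_isPairModel_of_net (F : Forb (forbiddenFamily d) H) (hd : 3 ≤ d)
    {a b c a' b' c' : W} (hab : H.Adj a b) (hac : H.Adj a c) (hbc : H.Adj b c)
    (hout : ∀ v, v ≠ a ∧ v ≠ b ∧ v ≠ c → ¬ (H.Adj v a ∧ H.Adj v b) ∧ ¬ (H.Adj v a ∧ H.Adj v c) ∧
      ¬ (H.Adj v b ∧ H.Adj v c))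
    (hindep : ∀ u, u ≠ a ∧ u ≠ b ∧ u ≠ c → ∀ v, v ≠ a ∧ v ≠ b ∧ v ≠ c → ¬ H.Adj u v)
    (ha' : a' ≠ a ∧ a' ≠ b ∧ a' ≠ c) (hb' : b' ≠ a ∧ b' ≠ b ∧ b' ≠ c)
    (hc' : c' ≠ a ∧ c' ≠ b ∧ c' ≠ c) (haa' : H.Adj a a') (hbb' : H.Adj b b') (hcc' : H.Adj c c') :
    ∃ A : W → Finset (Fin d), Function.Injective A ∧ IsPairModel H A := by
  have hMindep : ∀ M : Finset W, (∀ v ∈ M, v ≠ a ∧ v ≠ b ∧ v ≠ c) →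
      ∀ u ∈ M, ∀ v ∈ M, ¬ H.Adj u v := fun M hM u hu v hv => hindep u (hM u hu) v (hM v hv)
  have hba' : ¬ H.Adj b a' := fun h => (hout a' ha').1 ⟨haa'.symm, h.symm⟩
  have hca' : ¬ H.Adj c a' := fun h => (hout a' ha').2.1 ⟨haa'.symm, h.symm⟩
  have hab' : ¬ H.Adj a b' := fun h => (hout b' hb').1 ⟨h.symm, hbb'.symm⟩
  have hcb' : ¬ H.Adj c b' := fun h => (hout b' hb').2.2 ⟨hbb'.symm, h.symm⟩
  have hac' : ¬ H.Adj a c' := fun h => (hout c' hc').2.1 ⟨h.symm, hcc'.symm⟩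
  have hbc' : ¬ H.Adj b c' := fun h => (hout c' hc').2.2 ⟨h.symm, hcc'.symm⟩
  refine exists_isPairModel_of_triangle hd hab hac hbc ?_ hindep ?_ ?_ ?_ ?_ ?_
  · rintro v ⟨hva, hvb, hvc⟩
    exact (hout v ⟨hva.ne, hvb.ne, hvc.ne⟩).1 ⟨hva, hvb⟩
  · intro u v hu _ _
    have := hout u hu
    tauto
  · intro M hM ha hb hc
    exact F.card_le_of_net_pendants hd hab hac hbc hbb' hcc' hab' hcb' hac' hbc'
      (hindep b' hb' c' hc') M (hMindep M hM) ha hb hc (fun v hv => hindep b' hb' v (hM v hv))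
      fun v hv => hindep c' hc' v (hM v hv)
  · intro M hM hb ha hc
    exact F.card_le_of_net_pendants hd hab.symm hbc hac haa' hcc' hba' hca' hbc' hac'
      (hindep a' ha' c' hc') M (hMindep M hM) hb ha hc (fun v hv => hindep a' ha' v (hM v hv))
      fun v hv => hindep c' hc' v (hM v hv)
  · intro M hM hc ha hb
    exact F.card_le_of_net_pendants hd hac.symm hbc.symm hab haa' hbb' hca' hba' hcb' hab'
      (hindep a' ha' b' hb') M (hMindep M hM) hc ha hb (fun v hv => hindep a' ha' v (hM v hv))
      fun v hv => hindep b' hb' v (hM v hv)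
  · intro M hM ha hb hc
    obtain ⟨φ, hφ⟩ := exists_embedding_K3Pend11 (s := 1) hab hac hbc hbb' hcc' hab' hcb' hac'
      hbc' (hindep b' hb' c' hc') {a'} (by simp) (by simp) (by simpa using haa')
      (by simpa using hba') (by simpa using hca') (by simpa using hindep b' hb' a' ha')
      (by simpa using hindep c' hc' a' ha')
    simp only [Finset.mem_singleton] at hφ
    refine F.card_le_of_K3Pend11 φ M (hMindep M hM) ?_ ?_
    · intro x hx
      rcases hφ x with h | h | h | h | h | h <;> rw [h] at hx
      · exact ha _ hx haa'
      · exact (hM _ hx).1 rfl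
      · exact (hM _ hx).2.1 rfl
      · exact (hM _ hx).2.2 rfl
      · exact hb _ hx hbb'
      · exact hc _ hx hcc'
    · intro x m hm
      rcases hφ x with h | h | h | h | h | h <;> rw [h]
      · exact hindep a' ha' m (hM m hm)
      · exact ha m hm
      · exact hb m hm
      · exact hc m hm
      · exact hindep b' hb' m (hM m hm)
      · exact hindep c' hc' m (hM m hm)

/-- Here `c` becomes the pair belonging to `a` and `b`. Only two singletons are used, in agreement
with the bound `(d - 2).choose 2` that comes from `K_3`. -/
theorem Forb.exists_isPairModel_of_triangle_simplicial (F : Forb (forbiddenFamily d) H)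
    (hd : 3 ≤ d) {a b c : W} (hab : H.Adj a b) (hac : H.Adj a c) (hbc : H.Adj b c)
    (hout : ∀ v, v ≠ a ∧ v ≠ b ∧ v ≠ c → ¬ (H.Adj v a ∧ H.Adj v b))
    (hindep : ∀ u, u ≠ a ∧ u ≠ b ∧ u ≠ c → ∀ v, v ≠ a ∧ v ≠ b ∧ v ≠ c → ¬ H.Adj u v)
    (hc : ∀ v, v ≠ a ∧ v ≠ b ∧ v ≠ c → ¬ H.Adj c v) :
    ∃ A : W → Finset (Fin d), Function.Injective A ∧ IsPairModel H A := by
  have hindep' : ∀ u, u ≠ a ∧ u ≠ b → ∀ v, v ≠ a ∧ v ≠ b → ¬ H.Adj u v := by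
    intro u hu v hv
    by_cases huc : u = c <;> by_cases hvc : v = c
    · rw [huc, hvc]
      exact H.loopless.irrefl _
    · rw [huc]
      exact hc v ⟨hv.1, hv.2, hvc⟩
    · rw [hvc]
      exact fun h => hc u ⟨hu.1, hu.2, huc⟩ h.symm
    · exact hindep u ⟨hu.1, hu.2, huc⟩ v ⟨hv.1, hv.2, hvc⟩
  refine F.exists_isPairModel_of_edge hd hab hindep' ?_ ?_
  · have key : ∀ u, H.Adj u a → H.Adj u b → u = c := by
      intro u hua hub
      by_contra hne
      exact hout u ⟨hua.ne, hub.ne, hne⟩ ⟨hua, hub⟩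
    exact fun u v huv hua hub hva hvb => huv ((key u hua hub).trans (key v hva hvb).symm)
  · intro M hM ha hb
    obtain ⟨f, hf⟩ := exists_embedding_K3 hab hac hbc
    have hcM : c ∉ M := fun h => ha c h hac
    refine F.card_le_of_K3 f M (fun u hu v hv => hindep' u (hM u hu) v (hM v hv)) ?_ ?_
    · simp only [hf, Fin.forall_fin_succ]
      simpa using ⟨fun h => (hM a h).1 rfl, fun h => (hM b h).2 rfl, hcM⟩
    · simp only [hf, Fin.forall_fin_succ]
      simpa using ⟨ha, hb, fun v hv => hc v ⟨(hM v hv).1, (hM v hv).2, fun h => hcM (h ▸ hv)⟩⟩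

theorem Forb.exists_isPairModel_of_diamond_free (F : Forb (forbiddenFamily d) H) (hd : 3 ≤ d)
    (hD : ∀ x y u v, H.Adj x y → H.Adj u x → H.Adj u y → H.Adj v x → H.Adj v y → u = v)
    {a b c : W} (hab : H.Adj a b) (hac : H.Adj a c) (hbc : H.Adj b c) :
    ∃ A : W → Finset (Fin d), Function.Injective A ∧ IsPairModel H A := by
  have hout : ∀ v, v ≠ a ∧ v ≠ b ∧ v ≠ c → ¬ (H.Adj v a ∧ H.Adj v b) ∧ ¬ (H.Adj v a ∧ H.Adj v c) ∧
      ¬ (H.Adj v b ∧ H.Adj v c) := fun v hv =>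
    ⟨fun h => hv.2.2 (hD a b v c hab h.1 h.2 hac.symm hbc.symm),
      fun h => hv.2.1 (hD a c v b hac h.1 h.2 hab.symm hbc),
      fun h => hv.1 (hD b c v a hbc h.1 h.2 hab hac)⟩
  -- If `u` sees `x`, then `u` misses `y` and `z`, and so does `v`, as otherwise a `C_4` through
  -- `ux` arises; hence `uv` and `yz` form a `2K_2`.
  have key : ∀ u v x y z, H.Adj x y → H.Adj x z → H.Adj y z → u ≠ y → u ≠ z → v ≠ x →
      ¬ (H.Adj u x ∧ H.Adj u y) → ¬ (H.Adj u x ∧ H.Adj u z) → ¬ (H.Adj v x ∧ H.Adj v y) →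
      ¬ (H.Adj v x ∧ H.Adj v z) → H.Adj u v → ¬ H.Adj u x := by
    intro u v x y z hxy hxz hyz huy huz hvx h1 h2 h3 h4 huv hux
    refine F.no_two_K2 huv hyz (fun h => h1 ⟨hux, h⟩) (fun h => h2 ⟨hux, h⟩) (fun h => ?_)
      (fun h => ?_)
    · exact F.no_C4 hux hxy h.symm huv.symm (fun h => h1 ⟨hux, h⟩) (fun h' => h3 ⟨h'.symm, h⟩) huy
        hvx.symm
    · exact F.no_C4 hux hxz h.symm huv.symm (fun h => h2 ⟨hux, h⟩) (fun h' => h4 ⟨h'.symm, h⟩) huz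
        hvx.symm
  have keya : ∀ u v, u ≠ a ∧ u ≠ b ∧ u ≠ c → v ≠ a ∧ v ≠ b ∧ v ≠ c → H.Adj u v → ¬ H.Adj u a :=
    fun u v hu hv => key u v a b c hab hac hbc hu.2.1 hu.2.2 hv.1 (hout u hu).1 (hout u hu).2.1
      (hout v hv).1 (hout v hv).2.1
  have keyb : ∀ u v, u ≠ a ∧ u ≠ b ∧ u ≠ c → v ≠ a ∧ v ≠ b ∧ v ≠ c → H.Adj u v → ¬ H.Adj u b :=
    fun u v hu hv => key u v b a c hab.symm hbc hac hu.1 hu.2.2 hv.2.1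
      (fun h => (hout u hu).1 h.symm) (hout u hu).2.2 (fun h => (hout v hv).1 h.symm)
      (hout v hv).2.2
  have hindep : ∀ u, u ≠ a ∧ u ≠ b ∧ u ≠ c → ∀ v, v ≠ a ∧ v ≠ b ∧ v ≠ c → ¬ H.Adj u v :=
    fun u hu v hv huv => F.no_two_K2 huv hab (keya u v hu hv huv) (keyb u v hu hv huv)
      (keya v u hv hu huv.symm) (keyb v u hv hu huv.symm)
  by_cases hc : ∃ v, (v ≠ a ∧ v ≠ b ∧ v ≠ c) ∧ H.Adj c v
  · by_cases hb : ∃ v, (v ≠ a ∧ v ≠ b ∧ v ≠ c) ∧ H.Adj b v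
    · by_cases ha : ∃ v, (v ≠ a ∧ v ≠ b ∧ v ≠ c) ∧ H.Adj a v
      · obtain ⟨a', ha', haa'⟩ := ha
        obtain ⟨b', hb', hbb'⟩ := hb
        obtain ⟨c', hc', hcc'⟩ := hc
        exact F.exists_isPairModel_of_net hd hab hac hbc hout hindep ha' hb' hc' haa' hbb' hcc'
      · have hp : ∀ v, v ≠ b ∧ v ≠ c ∧ v ≠ a → v ≠ a ∧ v ≠ b ∧ v ≠ c := fun v hv =>
          ⟨hv.2.2, hv.1, hv.2.1⟩
        exact F.exists_isPairModel_of_triangle_simplicial hd hbc hab.symm hac.symm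
          (fun v hv => (hout v (hp v hv)).2.2) (fun u hu v hv => hindep u (hp u hu) v (hp v hv))
          (fun v hv h => ha ⟨v, hp v hv, h⟩)
    · have hp : ∀ v, v ≠ a ∧ v ≠ c ∧ v ≠ b → v ≠ a ∧ v ≠ b ∧ v ≠ c := fun v hv =>
        ⟨hv.1, hv.2.2, hv.2.1⟩
      exact F.exists_isPairModel_of_triangle_simplicial hd hac hab hbc.symm
        (fun v hv => (hout v (hp v hv)).2.1) (fun u hu v hv => hindep u (hp u hu) v (hp v hv))
        (fun v hv h => hb ⟨v, hp v hv, h⟩)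
  · exact F.exists_isPairModel_of_triangle_simplicial hd hab hac hbc
      (fun v hv => (hout v hv).1) hindep (fun v hv h => hc ⟨v, hv, h⟩)

theorem Forb.exists_isPairModel_of_path (F : Forb (forbiddenFamily d) H) (hd : 3 ≤ d)
    (hK3 : ∀ a b c, H.Adj a b → H.Adj a c → ¬ H.Adj b c) {x a b y : W} (hxa : H.Adj x a)
    (hab : H.Adj a b) (hby : H.Adj b y) (hxy : ¬ H.Adj x y) :
    ∃ A : W → Finset (Fin d), Function.Injective A ∧ IsPairModel H A := by
  have hxb : ¬ H.Adj x b := hK3 a x b hxa.symm hab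
  have hay : ¬ H.Adj a y := hK3 b a y hab.symm hby
  -- If `u` sees `a`, then excluding triangles, `C_4` and `C_5` leaves no edge between `uv` and
  -- `by`, a `2K_2`. The second end of the path is handled by symmetry.
  have key : ∀ a b y, H.Adj a b → H.Adj b y → ∀ u v, u ≠ a → u ≠ b → v ≠ a → v ≠ b → a ≠ y →
      H.Adj u v → H.Adj u a → False := by
    intro a b y hab hby u v hua' hub' hva' hvb' hay' huv hua
    have hay : ¬ H.Adj a y := hK3 b a y hab.symm hby
    have hva : ¬ H.Adj v a := hK3 u v a huv hua
    have hub : ¬ H.Adj u b := hK3 a u b hua.symm hab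
    have hvb : ¬ H.Adj v b := fun h =>
      F.no_C4 hua hab h.symm huv.symm hub (fun h => hva h.symm) hub' hva'.symm
    have huy : ¬ H.Adj u y := fun h =>
      F.no_C4 hua hab hby h.symm hub hay hub' hay'
    have hvy : ¬ H.Adj v y := fun h =>
      F.no_C5 huv.symm hua hab hby h.symm hva hvb hub huy hay
    exact F.no_two_K2 huv hby hub huy hvb hvy
  have hay' : a ≠ y := by rintro rfl; exact hxy hxa
  have hbx' : b ≠ x := by rintro rfl; exact hxy hby
  have hindep : ∀ u, u ≠ a ∧ u ≠ b → ∀ v, v ≠ a ∧ v ≠ b → ¬ H.Adj u v := by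
    intro u hu v hv huv
    refine F.no_two_K2 huv hab (fun h => ?_) (fun h => ?_) (fun h => ?_) (fun h => ?_)
    · exact key a b y hab hby u v hu.1 hu.2 hv.1 hv.2 hay' huv h
    · exact key b a x hab.symm hxa.symm u v hu.2 hu.1 hv.2 hv.1 hbx' huv h
    · exact key a b y hab hby v u hv.1 hv.2 hu.1 hu.2 hay' huv.symm h
    · exact key b a x hab.symm hxa.symm v u hv.2 hv.1 hu.2 hu.1 hbx' huv.symm h
  refine F.exists_isPairModel_of_edge hd hab hindep
    (fun u v _ hua hub _ _ => hK3 u a b hua hub hab) ?_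
  intro M hM ha hb
  obtain ⟨f, hf⟩ := exists_embedding_pathGraph_four hxa hab hby hxb hay hxy
  refine F.card_le_of_pathGraph_four f M (fun u hu v hv => hindep u (hM u hu) v (hM v hv)) ?_ ?_
  · simp only [hf, Fin.forall_fin_succ]
    simpa using ⟨fun h => ha x h hxa.symm, fun h => (hM a h).1 rfl, fun h => (hM b h).2 rfl,
      fun h => hb y h hby⟩
  · simp only [hf, Fin.forall_fin_succ]
    simpa using ⟨fun v hv => hindep x ⟨hxa.ne, hbx'.symm⟩ v (hM v hv), ha, hb,
      fun v hv => hindep y ⟨hay'.symm, hby.ne'⟩ v (hM v hv)⟩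

/-- An edge avoiding `a` is disjoint from `ab` and unjoined to it, since a link to `a` would, by
`hP4`, give `b` a second neighbour. So all edges meet `a`, which is the only singleton. -/
theorem Forb.exists_isPairModel_of_star (F : Forb (forbiddenFamily d) H) (hd : 3 ≤ d)
    (hP4 : ∀ x a b y, H.Adj x a → H.Adj a b → H.Adj b y → H.Adj x y)
    {a b : W} (hab : H.Adj a b) (hb : ∀ v, H.Adj b v → v = a) :
    ∃ A : W → Finset (Fin d), Function.Injective A ∧ IsPairModel H A := by
  have key : ∀ u v, v ≠ a → H.Adj u v → ¬ H.Adj u a := fun u v hv huv hua =>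
    hv (hb v (hP4 v u a b huv.symm hua hab).symm)
  have hindep : ∀ u, u ≠ a → ∀ v, v ≠ a → ¬ H.Adj u v := fun u hu v hv huv =>
    F.no_two_K2 huv hab (key u v hv huv) (fun h => hu (hb u h.symm)) (key v u hu huv.symm)
      (fun h => hv (hb v h.symm))
  refine exists_isPairModel_of_split hd {a} (by simpa using by omega) (by simp)
    (by simpa using hindep) ?_ ?_ ?_ ?_
  · intro v _ S hS _
    exact (Finset.card_le_card hS).trans (by simp)
  · intro u v _ _ _ x hx y hy hxy
    rw [Finset.mem_singleton] at hx hy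
    exact absurd (hx.trans hy.symm) hxy
  · intro x hx M hM hMx
    rw [Finset.mem_singleton] at hx
    subst hx
    rw [Finset.card_singleton]
    exact F.card_le_of_star hd x M
      (fun u hu v hv => hindep u (by simpa using hM u hu) v (by simpa using hM v hv))
      fun v hv => ((hMx v hv x (by simp)).2 rfl).symm
  · intro M hM hMa
    rw [Finset.card_singleton]
    obtain ⟨f, hf⟩ := exists_embedding_K2 hab
    have hMa' : ∀ v ∈ M, v ≠ a := fun v hv => by simpa using hM v hv
    have ha : ∀ v ∈ M, ¬ H.Adj a v := fun v hv h => hMa v hv a (by simp) h.symm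
    refine F.card_le_of_K2 f M (fun u hu v hv => hindep u (hMa' u hu) v (hMa' v hv)) ?_ ?_
    · simp only [hf, Fin.forall_fin_two]
      exact ⟨fun h => hMa' a h rfl, fun h => ha b h hab⟩
    · simp only [hf, Fin.forall_fin_two]
      exact ⟨ha, fun v hv h => hMa' v hv (hb v h)⟩

theorem Forb.exists_isPairModel (F : Forb (forbiddenFamily d) H) (hd : 3 ≤ d) :
    ∃ A : W → Finset (Fin d), Function.Injective A ∧ IsPairModel H A := by
  classical
  by_cases hK4 : ∀ a b c v, H.Adj a b → H.Adj a c → H.Adj b c →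
    ¬ (H.Adj v a ∧ H.Adj v b ∧ H.Adj v c)
  · by_cases hK3 : ∀ a b c, H.Adj a b → H.Adj a c → ¬ H.Adj b c
    · by_cases hP4 : ∀ x a b y, H.Adj x a → H.Adj a b → H.Adj b y → H.Adj x y
      · by_cases hE : ∀ a b, ¬ H.Adj a b
        · refine exists_isPairModel_of_split hd ∅ (by simp) (by simp)
            (fun u _ v _ => hE u v) (fun v _ S hS _ => ?_) (by simp) (by simp) fun M _ _ => ?_
          · simp [Finset.subset_empty.1 hS]
          · obtain ⟨f, -⟩ := exists_embedding_of_fin (H := H) (B := K 0) Fin.elim0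
              (fun i => i.elim0) (fun i => i.elim0)
            exact F.card_le_of_K (Or.inl rfl) f M (fun u _ v _ => hE u v) (fun i => i.elim0)
              (fun i => i.elim0)
        · push Not at hE
          obtain ⟨a, b, hab⟩ := hE
          -- One end of the edge is a leaf: further neighbours `x` of `a` and `y` of `b` would be
          -- adjacent by `hP4` and close an induced `C_4`.
          by_cases hb : ∀ v, H.Adj b v → v = a
          · exact F.exists_isPairModel_of_star hd hP4 hab hb
          · push Not at hb
            obtain ⟨y, hby, hya⟩ := hb
            refine F.exists_isPairModel_of_star hd hP4 hab.symm fun x hax => ?_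
            by_contra hxb
            exact F.no_C4 hax.symm hab hby (hP4 x a b y hax.symm hab hby).symm
              (hK3 a x b hax hab) (hK3 b a y hab.symm hby) hxb hya.symm
      · push Not at hP4
        obtain ⟨x, a, b, y, hxa, hab, hby, hxy⟩ := hP4
        exact F.exists_isPairModel_of_path hd hK3 hxa hab hby hxy
    · push Not at hK3
      obtain ⟨a, b, c, hab, hac, hbc⟩ := hK3
      by_cases hD : ∀ x y u v, H.Adj x y → H.Adj u x → H.Adj u y → H.Adj v x → H.Adj v y → u = v
      · exact F.exists_isPairModel_of_diamond_free hd hD hab hac hbc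
      · push Not at hD
        obtain ⟨a, b, c, c', hab, hca, hcb, hca', hcb', hne⟩ := hD
        have hcc : ¬ H.Adj c c' := fun h => hK4 a b c c' hab hca.symm hcb.symm ⟨hca', hcb', h.symm⟩
        rcases F.simplicial_of_diamond hK4 hab hca.symm hcb.symm hca'.symm hcb'.symm hcc hne
          with h | h
        · exact F.exists_isPairModel_of_diamond hd hK4 hab hca'.symm hcb'.symm hca.symm hcb.symm
            (fun h => hcc h.symm) hne.symm h
        · exact F.exists_isPairModel_of_diamond hd hK4 hab hca.symm hcb.symm hca'.symm hcb'.symm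
            hcc hne h
  · push Not at hK4
    obtain ⟨a, b, c, v, hab, hac, hbc, hva, hvb, hvc⟩ := hK4
    -- A clique of maximum order has at least four vertices here, and no vertex outside it can be
    -- complete to it.
    obtain ⟨C, hC, hmax⟩ := Finset.exists_max_image
      (Finset.univ.filter fun C : Finset W => ∀ u ∈ C, ∀ v ∈ C, u ≠ v → H.Adj u v) Finset.card
      ⟨∅, by simp⟩
    simp only [Finset.mem_filter, Finset.mem_univ, true_and] at hC hmax
    refine F.exists_isPairModel_of_large_clique hd C hC ?_ fun w hw => ?_
    · have h := hmax {v, a, b, c} (by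
        simp [hab, hac, hbc, hva, hvb, hvc, hab.symm, hac.symm, hbc.symm, hva.symm, hvb.symm,
          hvc.symm])
      rwa [Finset.card_insert_of_notMem (by simp [hva.ne, hvb.ne, hvc.ne]),
        Finset.card_eq_three.2 ⟨a, b, c, hab.ne, hac.ne, hbc.ne, rfl⟩] at h
    · by_contra! hadj
      have h := hmax (insert w C) (by
        intro x hx y hy hxy
        rw [Finset.mem_insert] at hx hy
        rcases hx with rfl | hx <;> rcases hy with rfl | hy
        · exact absurd rfl hxy
        · exact hadj y hy
        · exact (hadj x hx).symm
        · exact hC x hx y hy hxy)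
      rw [Finset.card_insert_of_notMem hw] at h
      omega

end Sufficiency

end PIntersection

theorem mainTheorem5 {V : Type*} [Finite V] (G : SimpleGraph V)
    (hisolated : ∀ u : V, ¬ G.IsIsolated u) (huniversal : ∀ u : V, ¬ G.IsUniversal u)
    (d : ℕ) (hd : 3 ≤ d) :
    List.TFAE [
      PIntersection.intersectionNumber G (d - 2) ≤ (d : ℕ∞),
      PIntersection.ArisesByCliques G (PIntersection.gStar d),
      PIntersection.Forb (PIntersection.forbiddenFamily d) (PIntersection.reduction G)] := by
  have : Fintype (Quotient (PIntersection.twinSetoid G)) := Fintype.ofFinite _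
  tfae_have 1 ↔ 2 := by
    rw [PIntersection.intersectionNumber_le_iff_exists_isPairModel G hisolated huniversal d hd,
      PIntersection.arisesByCliques_gStar_iff G d hd]
  tfae_have 2 ↔ 3 := by
    rw [PIntersection.arisesByCliques_gStar_iff G d hd,
      PIntersection.exists_isPairModel_iff_reduction]
    exact ⟨fun ⟨_, hinj, hA⟩ => PIntersection.forb_of_isPairModel hd hinj hA,
      fun F => F.exists_isPairModel hd⟩
  tfae_finish
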